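/- **Setup.** Fix the directed or the undirected case. For $k\in\mathbb N$ let $W=(W(t))_{t\ge0}=((W_1(t),\dots,W_k(t)))_{t\ge 0}$ be the walk on $\mathbb Z^k$ started from $0$ whose coordinates are independent, each being a rate-$(1/k)$ Poisson process in the directed case, and a rate-$(1/k)$ continuous-time simple symmetric random walk on $\mathbb Z$ in the undirected case. Write $\mu_t$ for the law of $W(t)$, $\nu_t$ for the law of $W_1(t)$, and $$Q_i(t)=-\log\nu_t(W_i(t)),\qquad Q(t)=-\log\mu_t(W(t))=\sum_{i=1}^k Q_i(t).$$ For $n\in\mathbb N$, the entropic time $t_0=t_0(n,k)\ge 0$ is defined by $\mathbb E[Q_1(t_0)]=(\log n)/k$ and, for $\alpha\in\mathbb R$, the cutoff time $t_\alpha=t_\alpha(n,k)\ge 0$ is defined by $$\mathbb E[Q_1(t_\alpha)]=\frac{\log n+\alpha\sqrt{vk}}{k},\qquad v=\mathrm{Var}(Q_1(t_0)).$$ Let $\Psi(\alpha)=\mathbb P(N(0,1)\ge\alpha)=(2\pi)^{-1/2}\int_\alpha^\infty e^{-y^2/2}\,dy$. **Proposition (CLT).** The variable $Q_1(t)$ is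 square integrable for all $k$ and all $t\ge0$. Let $(k_N)_{N\in\mathbb N}$ and $(n_N)_{N\in\mathbb N}$ be sequences of natural numbers with $k_N\to\infty$ and $\log k_N=o(\log n_N)$ as $N\to\infty$. Then, in both the directed and the undirected cases, the time $t_0=t_0(n_N,k_N)$ exists and is unique for all sufficiently large $N$; and for each $\alpha\in\mathbb R$ the time $t_\alpha=t_\alpha(n_N,k_N)$ exists and is unique for all sufficiently large $N$ (depending on $\alpha$), and, with $$\omega=\mathrm{Var}(Q(t_0))^{1/4}=(vk_N)^{1/4},$$ both $$\mathbb P\big(Q(t_\alpha)\le\log n_N+\omega\big)\to\Psi(\alpha)\quad\text{and}\quad \mathbb P\big(Q(t_\alpha)\le\log n_N-\omega\big)\to\Psi(\alpha)\qquad\text{as }N\to\infty.$$ -/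

import Mathlib

open MeasureTheory ProbabilityTheory Filter Topology
open scoped NNReal ENNReal

/-- Whether the random walk on the Cayley graph is the directed or the undirected one. -/
inductive WalkKind
  | directed
  | undirected

/-- The law of discrete-time simple random walk on `ℤ`, started from `0`, after `m` steps. -/
noncomputable def srwLaw : ℕ → Measure ℤ
  | 0 => Measure.dirac 0
  | m + 1 => (2⁻¹ : ℝ≥0∞) • (srwLaw m).map (fun x => x + 1)
      + (2⁻¹ : ℝ≥0∞) • (srwLaw m).map (fun x => x - 1)

/-- The law at time `s` of the rate-1 walk on `ℤ` started from `0`: in the directed case, that of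
a rate-1 Poisson process, i.e. `Po(s)`; in the undirected case, that of the rate-1 continuous-time
simple random walk, i.e. of simple random walk after an independent `Po(s)` number of steps. -/
noncomputable def rateOneLaw : WalkKind → ℝ≥0 → Measure ℤ
  | .directed, s => (poissonMeasure s).map (fun m : ℕ => (m : ℤ))
  | .undirected, s => (poissonMeasure s).bind srwLaw

/-- `X` is a rate-`r` Poisson process (directed case), respectively a rate-`r` continuous-time
simple random walk on `ℤ` (undirected case), started from `0`. -/
structure IsCoordinateWalk {Ω : Type*} [MeasurableSpace Ω] (c : WalkKind) (r : ℝ≥0)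
    (P : Measure Ω) (X : ℝ≥0 → Ω → ℤ) : Prop where
  measurable : ∀ t, Measurable (X t)
  start_zero : ∀ᵐ ω ∂P, X 0 ω = 0
  indep_increments : HasIndepIncrements X P
  increment_law : ∀ s t : ℝ≥0, s ≤ t →
    P.map (fun ω => X t ω - X s ω) = rateOneLaw c (r * (t - s))
  right_continuous : ∀ᵐ ω ∂P, ∀ t, ContinuousWithinAt (fun u => X u ω) (Set.Ici t) t

/-- `W` is the auxiliary walk on `ℤ^k`: its `k` coordinates are independent rate-`1/k` walks. -/
structure IsAuxiliaryWalk {Ω : Type*} [MeasurableSpace Ω] (c : WalkKind) (k : ℕ)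
    (P : Measure Ω) (W : ℝ≥0 → Ω → Fin k → ℤ) : Prop where
  coordinate : ∀ i : Fin k, IsCoordinateWalk c (1 / (k : ℝ≥0)) P (fun t ω => W t ω i)
  independent : iIndepFun (fun (i : Fin k) (ω : Ω) (t : ℝ≥0) => W t ω i) P

/-- The function `x ↦ -log ν({x})`, for a law `ν`. -/
noncomputable def negLogMass {S : Type*} [MeasurableSpace S] (ν : Measure S) (x : S) : ℝ :=
  -Real.log (ν.real {x})

/-- `Q(t) = -log μ_t(W(t))`, where `μ_t` is the law of `W(t)` under `P`. -/
noncomputable def logLik {Ω : Type*} [MeasurableSpace Ω] {k : ℕ}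
    (P : Measure Ω) (W : ℝ≥0 → Ω → Fin k → ℤ) (t : ℝ≥0) (ω : Ω) : ℝ :=
  negLogMass (P.map (W t)) (W t ω)

/-- `ν_t`, the law of one coordinate of the auxiliary walk at time `t`. -/
noncomputable def coordLaw (c : WalkKind) (k : ℕ) (t : ℝ≥0) : Measure ℤ :=
  rateOneLaw c (t / k)

/-- `𝔼[Q₁(t)]`, where `Q₁(t) = -log ν_t(W₁(t))` and `W₁(t)` has law `ν_t`. -/
noncomputable def meanQ₁ (c : WalkKind) (k : ℕ) (t : ℝ≥0) : ℝ :=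
  ∫ x, negLogMass (coordLaw c k t) x ∂(coordLaw c k t)

/-- `Var(Q₁(t))`, where `Q₁(t) = -log ν_t(W₁(t))` and `W₁(t)` has law `ν_t`. -/
noncomputable def varQ₁ (c : WalkKind) (k : ℕ) (t : ℝ≥0) : ℝ :=
  Var[negLogMass (coordLaw c k t); coordLaw c k t]

/-- `t₀` is an entropic time for `(n, k)`: `𝔼[Q₁(t₀)] = (log n) / k`. -/
def IsEntropicTime (c : WalkKind) (n k : ℕ) (t₀ : ℝ≥0) : Prop :=
  meanQ₁ c k t₀ = Real.log n / k

/-- `t` is a cutoff time with parameter `α` for `(n, k)`, given the entropic time `t₀`: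
`𝔼[Q₁(t)] = (log n + α √(v k)) / k` where `v = Var(Q₁(t₀))`. -/
def IsCutoffTime (c : WalkKind) (n k : ℕ) (t₀ : ℝ≥0) (α : ℝ) (t : ℝ≥0) : Prop :=
  meanQ₁ c k t = (Real.log n + α * √(varQ₁ c k t₀ * k)) / k

/-- `Ψ(α) = ℙ(N(0,1) ≥ α)`. -/
noncomputable def gaussianTail (α : ℝ) : ℝ := (gaussianReal 0 1).real (Set.Ici α)

/-! By independence, `Q(t)` is almost surely a sum of `k` i.i.d. copies of the surprisal `-log p_s`
of a rate-1 walk at time `s = t / k`, so the statement is a central limit theorem for a triangular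
array whose summand depends on `N` through `s`. Write `h(s)` for the entropy, which is the mean of a
summand, `v(s)` for its variance and `l = log n`.

Existence and uniqueness of the times hold because `h` is a homeomorphism of the half-line
(`entropyHomeo`). It is strictly increasing by Gibbs' inequality, since the law at a later time is a
nontrivial mixture of translates of the law at an earlier one; it vanishes at `0`; and it is
unbounded because `p_s ≤ C / √s`.

At the cutoff time the mean of `Q` exceeds `l` by exactly `α √(vk)`, and the shift `(vk)^(1/4)` is
negligible against `√(vk)` once `vk → ∞`. So four facts suffice (`EntropicRegime.Conclusion`): `vk =
o(l²)`, which makes the cutoff time exist with entropy asymptotic to that of the entropic time; `vk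
→ ∞`; equality of the two variances to first order; and the Lyapunov condition that the kurtosis of
a summand is `o(k)`. `tendsto_charFun_surprisal_pow` and Lévy's continuity theorem then give the
normal limit.

These facts are checked along ultrafilters, on which `s` tends to `0`, to a positive number or to
infinity. A positive limit is handled by continuity. When `s → ∞`, the local limit theorem
`tendsto_scaledDensity`, with an integrable envelope for the densities, shows that the moments of
the surprisal recentred by `log √s` tend to those of a Gaussian surprisal, whose variance is
positive. When `s → 0`, a single jump dominates: it has probability about `s` and surprisal about
`log (1/s)`, so the `j`-th moment is asymptotic to `s (log (1/s))^j` and `v` to `h log (1/h)`. Then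
`vk / l²` is of order `log (1/h) / l`, at most `log k / l`, which is where `log k = o(log n)` is
decisive. -/

/-! ### The walk as a Poisson mixture of its skeleton. -/

/-- The law of the discrete-time skeleton of the walk after `m` steps. -/
noncomputable def stepLaw : WalkKind → ℕ → Measure ℤ
  | .directed, m => Measure.dirac (m : ℤ)
  | .undirected, m => srwLaw m

/-- The probability that a `Po(s)` variable equals `m`. -/
noncomputable def poissonWeight (s : ℝ≥0) (m : ℕ) : ℝ :=
  Real.exp (-s) * (s : ℝ) ^ m / m.factorial

lemma poissonWeight_nonneg (s : ℝ≥0) (m : ℕ) : 0 ≤ poissonWeight s m := by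
  unfold poissonWeight; positivity

lemma rateOneLaw_eq_sum (c : WalkKind) (s : ℝ≥0) :
    rateOneLaw c s =
      Measure.sum (fun m => ENNReal.ofReal (poissonWeight s m) • stepLaw c m) := by
  cases c with
  | directed =>
    simp only [rateOneLaw, stepLaw, poissonWeight]
    rw [← Measure.bind_dirac_eq_map _ .of_discrete, poissonMeasure,
      Measure.bind, Measure.map_sum Measurable.of_discrete.aemeasurable, Measure.join_sum]
    congr 1; ext1 m
    rw [← Measure.bind, Measure.bind_smul, Measure.dirac_bind .of_discrete]
  | undirected =>
    simp only [rateOneLaw, stepLaw, poissonWeight]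
    rw [poissonMeasure,
      Measure.bind, Measure.map_sum Measurable.of_discrete.aemeasurable, Measure.join_sum]
    congr 1; ext1 m
    rw [← Measure.bind, Measure.bind_smul, Measure.dirac_bind .of_discrete]

instance isProbabilityMeasure_srwLaw (m : ℕ) : IsProbabilityMeasure (srwLaw m) := by
  induction m with
  | zero => exact Measure.dirac.isProbabilityMeasure
  | succ m ih =>
    constructor
    simp only [srwLaw, Measure.add_apply, Measure.smul_apply, smul_eq_mul]
    rw [Measure.map_apply .of_discrete .univ, Measure.map_apply .of_discrete .univ]
    simp [ENNReal.inv_two_add_inv_two]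

instance isProbabilityMeasure_stepLaw (c : WalkKind) (m : ℕ) :
    IsProbabilityMeasure (stepLaw c m) := by
  cases c <;> simp only [stepLaw] <;> infer_instance

lemma lintegral_rateOneLaw (c : WalkKind) (s : ℝ≥0) (f : ℤ → ℝ≥0∞) :
    ∫⁻ x, f x ∂(rateOneLaw c s)
      = ∑' m, ENNReal.ofReal (poissonWeight s m) * ∫⁻ x, f x ∂(stepLaw c m) := by
  rw [rateOneLaw_eq_sum, lintegral_sum_measure]
  simp [lintegral_smul_measure]

lemma tsum_ofReal_poissonWeight (s : ℝ≥0) :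
    ∑' m, ENNReal.ofReal (poissonWeight s m) = 1 := by
  have h := hasSum_one_poissonMeasure s
  rw [← ENNReal.ofReal_tsum_of_nonneg (poissonWeight_nonneg s) h.summable]
  simp [poissonWeight, h.tsum_eq]

instance isProbabilityMeasure_rateOneLaw (c : WalkKind) (s : ℝ≥0) :
    IsProbabilityMeasure (rateOneLaw c s) := by
  constructor
  rw [← lintegral_one, lintegral_rateOneLaw]
  simp [tsum_ofReal_poissonWeight]

lemma srwLaw_ae_natAbs_le (m : ℕ) : ∀ᵐ x ∂srwLaw m, x.natAbs ≤ m := by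
  induction m with
  | zero => simp [srwLaw, ae_dirac_eq]
  | succ m ih =>
    rw [srwLaw, ae_add_measure_iff]
    constructor <;> refine Measure.ae_smul_measure ?_ _
    · rw [ae_map_iff (by fun_prop) (by measurability)]
      filter_upwards [ih] with x hx; omega
    · rw [ae_map_iff (by fun_prop) (by measurability)]
      filter_upwards [ih] with x hx; omega

lemma stepLaw_ae_natAbs_le (c : WalkKind) (m : ℕ) : ∀ᵐ x ∂stepLaw c m, x.natAbs ≤ m := by
  cases c with
  | directed => simp [stepLaw, ae_dirac_eq]
  | undirected => exact srwLaw_ae_natAbs_le m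

/-! ### Lower bounds on the probability mass function. -/

/-- The states that the walk can visit. -/
def reachable : WalkKind → ℤ → Prop
  | .directed, x => 0 ≤ x
  | .undirected, _ => True

/-- The single path with all steps in one direction already has this probability. -/
lemma srwLaw_endpoint (m : ℕ) :
    (2⁻¹ : ℝ≥0∞) ^ m ≤ srwLaw m {(m : ℤ)} ∧ (2⁻¹ : ℝ≥0∞) ^ m ≤ srwLaw m {-(m : ℤ)} := by
  induction m with
  | zero => simp [srwLaw]
  | succ m ih =>
    simp only [srwLaw, Measure.add_apply, Measure.smul_apply, smul_eq_mul]
    rw [Measure.map_apply (by fun_prop) (by measurability),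
      Measure.map_apply (by fun_prop) (by measurability),
      Measure.map_apply (by fun_prop) (by measurability),
      Measure.map_apply (by fun_prop) (by measurability)]
    have h1 : (fun x : ℤ => x + 1) ⁻¹' {((m + 1 : ℕ) : ℤ)} = {(m : ℤ)} := by
      ext x; simp
    have h2 : (fun x : ℤ => x - 1) ⁻¹' {-((m + 1 : ℕ) : ℤ)} = {-(m : ℤ)} := by
      ext x; simp only [Set.mem_preimage, Set.mem_singleton_iff]; push_cast; omega
    rw [h1, h2, pow_succ']
    constructor
    · exact le_add_right (by gcongr; exact ih.1)
    · exact le_add_left (by gcongr; exact ih.2)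

lemma stepLaw_natAbs_ge (c : WalkKind) {x : ℤ} (hx : reachable c x) :
    (2⁻¹ : ℝ≥0∞) ^ x.natAbs ≤ stepLaw c x.natAbs {x} := by
  cases c with
  | directed =>
    have : ((x.natAbs : ℕ) : ℤ) = x := Int.natAbs_of_nonneg hx
    simp only [stepLaw]
    rw [Measure.dirac_apply' _ (by measurability)]
    rw [Set.indicator_of_mem (by simp only [Set.mem_singleton_iff]; exact this)]
    exact pow_le_one₀ (by simp) (by simp)
  | undirected =>
    simp only [stepLaw]
    rcases Int.natAbs_eq x with h | h
    · have := (srwLaw_endpoint x.natAbs).1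
      rwa [← h] at this
    · have := (srwLaw_endpoint x.natAbs).2
      rwa [← h] at this

/-- The probability mass function of the rate-1 walk at time `s`. -/
noncomputable def walkPmf (c : WalkKind) (s : ℝ≥0) (x : ℤ) : ℝ := (rateOneLaw c s).real {x}

lemma walkPmf_nonneg (c : WalkKind) (s : ℝ≥0) (x : ℤ) : 0 ≤ walkPmf c s x := measureReal_nonneg

lemma walkPmf_le_one (c : WalkKind) (s : ℝ≥0) (x : ℤ) : walkPmf c s x ≤ 1 := measureReal_le_one

/-- Only the event of exactly `|x|` jumps, all towards `x`, is kept. The bound is crude, but it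
makes the surprisal at most quadratic in `|x|`, hence integrable to every power. -/
lemma le_walkPmf (c : WalkKind) (s : ℝ≥0) {x : ℤ} (hx : reachable c x) :
    poissonWeight s x.natAbs * (2⁻¹ : ℝ) ^ x.natAbs ≤ walkPmf c s x := by
  have h : ENNReal.ofReal (poissonWeight s x.natAbs) * stepLaw c x.natAbs {x}
      ≤ rateOneLaw c s {x} := by
    rw [← lintegral_indicator_one (μ := rateOneLaw c s) (measurableSet_singleton x),
      lintegral_rateOneLaw]
    refine le_trans (le_of_eq ?_) (ENNReal.le_tsum x.natAbs)
    rw [lintegral_indicator_one (measurableSet_singleton x)]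
  have h2 := (mul_le_mul_right (stepLaw_natAbs_ge c hx)
    (ENNReal.ofReal (poissonWeight s x.natAbs))).trans h
  have h3 := ENNReal.toReal_mono (measure_ne_top _ _) h2
  rw [ENNReal.toReal_mul, ENNReal.toReal_ofReal (poissonWeight_nonneg _ _)] at h3
  simpa [walkPmf, measureReal_def] using h3

lemma walkPmf_pos (c : WalkKind) {s : ℝ≥0} (hs : 0 < s) {x : ℤ} (hx : reachable c x) :
    0 < walkPmf c s x := by
  refine lt_of_lt_of_le ?_ (le_walkPmf c s hx)
  have : (0 : ℝ) < s := hs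
  unfold poissonWeight; positivity

lemma walkPmf_of_not_reachable (c : WalkKind) (s : ℝ≥0) {x : ℤ} (hx : ¬ reachable c x) :
    walkPmf c s x = 0 := by
  cases c with
  | undirected => simp [reachable] at hx
  | directed =>
    simp only [walkPmf, rateOneLaw]
    rw [measureReal_def, Measure.map_apply .of_discrete (by measurability)]
    have : (fun m : ℕ => (m : ℤ)) ⁻¹' {x} = ∅ := by
      ext m; simp [reachable] at hx ⊢; omega
    simp [this]

lemma reachable_zero (c : WalkKind) : reachable c 0 := by cases c <;> simp [reachable]

lemma exp_neg_le_walkPmf_zero (c : WalkKind) (s : ℝ≥0) : Real.exp (-s) ≤ walkPmf c s 0 := by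
  simpa [poissonWeight] using le_walkPmf c s (reachable_zero c)

/-! ### Integrals as sums, and moments of the walk. -/

lemma integrable_iff_summable_of_countable {X E : Type*} [MeasurableSpace X] [Countable X]
    [MeasurableSingletonClass X] [NormedAddCommGroup E] (μ : Measure X) [IsFiniteMeasure μ]
    {f : X → E} : Integrable f μ ↔ Summable (fun x => μ.real {x} * ‖f x‖) := by
  conv_lhs => rw [← Measure.sum_smul_dirac μ]
  rw [integrable_sum_dirac_iff (fun x => measure_ne_top _ _)]
  rfl

lemma hasSum_integral_of_countable {X E : Type*} [MeasurableSpace X] [Countable X]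
    [MeasurableSingletonClass X] [NormedAddCommGroup E] [NormedSpace ℝ E] [CompleteSpace E]
    (μ : Measure X) [IsFiniteMeasure μ] {f : X → E} (hf : Integrable f μ) :
    HasSum (fun x => μ.real {x} • f x) (∫ x, f x ∂μ) := by
  have h := hasSum_integral_sum_dirac (f := f) (x := id) (c := fun x => μ {x})
    (fun x => measure_ne_top _ _) ((integrable_iff_summable_of_countable μ).1 hf)
  simp only [id] at h
  rwa [Measure.sum_smul_dirac μ] at h

lemma integrable_rateOneLaw_iff {E : Type*} [NormedAddCommGroup E] (c : WalkKind) (s : ℝ≥0)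
    {f : ℤ → E} :
    Integrable f (rateOneLaw c s) ↔ Summable (fun x => walkPmf c s x * ‖f x‖) :=
  integrable_iff_summable_of_countable _

lemma hasSum_integral_rateOneLaw {E : Type*} [NormedAddCommGroup E] [NormedSpace ℝ E]
    [CompleteSpace E] (c : WalkKind) (s : ℝ≥0) {f : ℤ → E} (hf : Integrable f (rateOneLaw c s)) :
    HasSum (fun x => walkPmf c s x • f x) (∫ x, f x ∂(rateOneLaw c s)) :=
  hasSum_integral_of_countable _ hf

lemma hasSum_walkPmf (c : WalkKind) (s : ℝ≥0) : HasSum (walkPmf c s) 1 := by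
  simpa using hasSum_integral_rateOneLaw c s (integrable_const (1 : ℝ))

lemma hasSum_integral_stepLaw {E : Type*} [NormedAddCommGroup E] [NormedSpace ℝ E]
    [CompleteSpace E] (c : WalkKind) (s : ℝ≥0) {f : ℤ → E} (hf : Integrable f (rateOneLaw c s)) :
    HasSum (fun m => poissonWeight s m • ∫ x, f x ∂(stepLaw c m))
      (∫ x, f x ∂(rateOneLaw c s)) := by
  rw [rateOneLaw_eq_sum] at hf ⊢
  have h := hasSum_integral_measure hf
  simpa [integral_smul_measure, ENNReal.toReal_ofReal (poissonWeight_nonneg s _)] using h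

/-- The displacement never exceeds the number of jumps, so an increasing function of it is dominated
by the same function of the Poisson count. -/
lemma lintegral_rateOneLaw_le (c : WalkKind) (s : ℝ≥0) {g : ℕ → ℝ≥0∞} (hg : Monotone g) :
    ∫⁻ x, g x.natAbs ∂(rateOneLaw c s) ≤ ∑' m, ENNReal.ofReal (poissonWeight s m) * g m := by
  rw [lintegral_rateOneLaw]
  refine ENNReal.tsum_le_tsum fun m => ?_
  gcongr
  calc ∫⁻ x, g x.natAbs ∂(stepLaw c m) ≤ ∫⁻ _, g m ∂(stepLaw c m) :=
        lintegral_mono_ae ((stepLaw_ae_natAbs_le c m).mono fun x hx => hg hx)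
    _ = g m := by simp

lemma integrable_of_abs_le {c : WalkKind} {s : ℝ≥0} {f : ℤ → ℝ} {g : ℕ → ℝ} (hg : Monotone g)
    (hg0 : ∀ m, 0 ≤ g m) (hfg : ∀ x, |f x| ≤ g x.natAbs)
    (hsum : Summable fun m => poissonWeight s m * g m) :
    Integrable f (rateOneLaw c s) ∧
      ∫ x, |f x| ∂(rateOneLaw c s) ≤ ∑' m, poissonWeight s m * g m := by
  have h0 : ∀ m, 0 ≤ poissonWeight s m * g m :=
    fun m => mul_nonneg (poissonWeight_nonneg s m) (hg0 m)
  have key : ∫⁻ x, ‖f x‖ₑ ∂(rateOneLaw c s)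
      ≤ ENNReal.ofReal (∑' m, poissonWeight s m * g m) := by
    rw [ENNReal.ofReal_tsum_of_nonneg h0 hsum]
    calc ∫⁻ x, ‖f x‖ₑ ∂(rateOneLaw c s)
        ≤ ∫⁻ x, ENNReal.ofReal (g x.natAbs) ∂(rateOneLaw c s) := by
          refine lintegral_mono fun x => ?_
          rw [Real.enorm_eq_ofReal_abs]
          exact ENNReal.ofReal_le_ofReal (hfg x)
      _ ≤ _ := lintegral_rateOneLaw_le c s
          (g := fun m => ENNReal.ofReal (g m)) (fun a b hab => ENNReal.ofReal_le_ofReal (hg hab))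
      _ = _ := by
          congr 1; ext m
          rw [ENNReal.ofReal_mul (poissonWeight_nonneg s m)]
  have hi : Integrable f (rateOneLaw c s) :=
    ⟨.of_discrete, lt_of_le_of_lt key ENNReal.ofReal_lt_top⟩
  refine ⟨hi, ?_⟩
  rw [integral_eq_lintegral_of_nonneg_ae (ae_of_all _ fun x => abs_nonneg _) .of_discrete]
  refine ENNReal.toReal_le_of_le_ofReal (tsum_nonneg h0) ?_
  simpa [Real.enorm_eq_ofReal_abs] using key

lemma pow_le_factorial_mul_exp (i m : ℕ) : (m : ℝ) ^ i ≤ i.factorial * Real.exp 1 ^ m := by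
  have h := Real.pow_div_factorial_le_exp (m : ℝ) (by positivity) i
  rw [div_le_iff₀ (by positivity)] at h
  rw [← Real.exp_nat_mul, mul_one]
  linarith

lemma summable_poissonWeight_mul_exp (s : ℝ≥0) :
    Summable fun m => poissonWeight s m * Real.exp 1 ^ m := by
  have h := (Real.summable_pow_div_factorial (s * Real.exp 1)).mul_left (Real.exp (-s))
  refine h.congr fun m => ?_
  unfold poissonWeight
  rw [mul_pow]; ring

lemma summable_poissonWeight_mul_pow (s : ℝ≥0) (i : ℕ) :
    Summable fun m => poissonWeight s m * (m : ℝ) ^ i := by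
  refine Summable.of_nonneg_of_le (fun m => mul_nonneg (poissonWeight_nonneg s m) (by positivity))
    (fun m => ?_) ((summable_poissonWeight_mul_exp s).mul_left (i.factorial : ℝ))
  calc poissonWeight s m * (m : ℝ) ^ i
      ≤ poissonWeight s m * (i.factorial * Real.exp 1 ^ m) :=
        mul_le_mul_of_nonneg_left (pow_le_factorial_mul_exp i m) (poissonWeight_nonneg s m)
    _ = _ := by ring

/-- Size-biasing of the Poisson law: combined with a shift of the index, whose `m = 0` term
vanishes, it yields the first two moments. -/
lemma poissonWeight_succ (s : ℝ≥0) (m : ℕ) :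
    poissonWeight s (m + 1) * (m + 1 : ℕ) = s * poissonWeight s m := by
  unfold poissonWeight
  rw [Nat.factorial_succ]
  push_cast
  field_simp
  ring

lemma hasSum_poissonWeight (s : ℝ≥0) : HasSum (poissonWeight s) 1 := hasSum_one_poissonMeasure s

lemma hasSum_poissonWeight_mul_natCast (s : ℝ≥0) :
    HasSum (fun m => poissonWeight s m * (m : ℝ)) s := by
  rw [← hasSum_nat_add_iff' 1]
  simp_rw [poissonWeight_succ]
  simpa using (hasSum_poissonWeight s).mul_left (s : ℝ)

lemma hasSum_poissonWeight_mul_sq (s : ℝ≥0) :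
    HasSum (fun m => poissonWeight s m * (m : ℝ) ^ 2) (s ^ 2 + s) := by
  rw [← hasSum_nat_add_iff' 1]
  have h := ((hasSum_poissonWeight_mul_natCast s).add (hasSum_poissonWeight s)).mul_left (s : ℝ)
  have e1 : (fun m => poissonWeight s (m + 1) * ((m + 1 : ℕ) : ℝ) ^ 2)
      = fun m => (s : ℝ) * (poissonWeight s m * m + poissonWeight s m) := by
    ext m
    rw [pow_two, ← mul_assoc, poissonWeight_succ]; push_cast; ring
  have e2 : (s : ℝ) ^ 2 + s - ∑ i ∈ Finset.range 1, poissonWeight s i * (i : ℝ) ^ 2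
      = s * (s + 1) := by simp; ring
  rw [e1, e2]
  exact h

lemma integrable_natAbs_pow (c : WalkKind) (s : ℝ≥0) (i : ℕ) :
    Integrable (fun x : ℤ => (x.natAbs : ℝ) ^ i) (rateOneLaw c s) :=
  (integrable_of_abs_le (g := fun m => (m : ℝ) ^ i)
    (fun a b hab => by dsimp only; gcongr) (fun m => by positivity)
    (fun x => by rw [abs_of_nonneg (by positivity)]) (summable_poissonWeight_mul_pow s i)).1

/-- The mean of the rate-1 walk at time `s`. -/
noncomputable def walkMean : WalkKind → ℝ≥0 → ℝ
  | .directed, s => s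
  | .undirected, _ => 0

lemma integrable_srwLaw (m : ℕ) (f : ℤ → ℝ) : Integrable f (srwLaw m) := by
  induction m generalizing f with
  | zero => exact integrable_dirac (by simp)
  | succ m ih =>
    rw [srwLaw]
    refine Integrable.add_measure (Integrable.smul_measure ?_ (by simp))
      (Integrable.smul_measure ?_ (by simp))
    · exact (integrable_map_measure .of_discrete .of_discrete).2 (ih _)
    · exact (integrable_map_measure .of_discrete .of_discrete).2 (ih _)

lemma integrable_srwLaw_complex (m : ℕ) (f : ℤ → ℂ) : Integrable f (srwLaw m) :=
  (integrable_srwLaw m (fun x => ‖f x‖)).mono' .of_discrete (ae_of_all _ fun _ => le_rfl)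

lemma integral_srwLaw_succ {E : Type*} [NormedAddCommGroup E] [NormedSpace ℝ E]
    (m : ℕ) (f : ℤ → E) (hf : ∀ m, Integrable f (srwLaw m)) :
    ∫ x, f x ∂(srwLaw (m + 1))
      = (2⁻¹ : ℝ) • ∫ x, f (x + 1) ∂(srwLaw m) + (2⁻¹ : ℝ) • ∫ x, f (x - 1) ∂(srwLaw m) := by
  have h := hf (m + 1)
  simp only [srwLaw] at h ⊢
  rw [integral_add_measure (h.mono_measure (Measure.le_add_right le_rfl))
    (h.mono_measure (Measure.le_add_left le_rfl)), integral_smul_measure, integral_smul_measure,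
    integral_map .of_discrete .of_discrete, integral_map .of_discrete .of_discrete]
  simp

lemma integral_sq_srwLaw (m : ℕ) : ∫ x, (x : ℝ) ^ 2 ∂(srwLaw m) = m := by
  induction m with
  | zero => simp [srwLaw]
  | succ m ih =>
    rw [integral_srwLaw_succ m _ (fun m => integrable_srwLaw m _), ← smul_add,
      ← integral_add (integrable_srwLaw m _) (integrable_srwLaw m _)]
    have : ∀ x : ℤ, (((x + 1 : ℤ) : ℝ) ^ 2 + ((x - 1 : ℤ) : ℝ) ^ 2) = 2 * (x : ℝ) ^ 2 + 2 := by
      intro x; push_cast; ring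
    simp_rw [this]
    rw [integral_add (integrable_srwLaw m _) (integrable_srwLaw m _), integral_const_mul, ih]
    simp
    ring

lemma integrable_sub_sq (c : WalkKind) (s : ℝ≥0) (a : ℝ) :
    Integrable (fun x : ℤ => ((x : ℝ) - a) ^ 2) (rateOneLaw c s) := by
  refine Integrable.mono' (g := fun x : ℤ => 2 * (x.natAbs : ℝ) ^ 2 + 2 * a ^ 2)
    (((integrable_natAbs_pow c s 2).const_mul 2).add (integrable_const _)) .of_discrete
    (ae_of_all _ fun x => ?_)
  rw [Real.norm_of_nonneg (sq_nonneg _), Nat.cast_natAbs, Int.cast_abs, sq_abs]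
  nlinarith [sq_nonneg ((x : ℝ) + a)]

lemma integral_sub_walkMean_sq (c : WalkKind) (s : ℝ≥0) :
    ∫ x, ((x : ℝ) - walkMean c s) ^ 2 ∂(rateOneLaw c s) = s := by
  have h := hasSum_integral_stepLaw c s (integrable_sub_sq c s (walkMean c s))
  refine h.unique ?_
  cases c with
  | directed =>
    simp only [stepLaw, walkMean, integral_dirac, smul_eq_mul]
    have h2 := ((hasSum_poissonWeight_mul_sq s).sub
      ((hasSum_poissonWeight_mul_natCast s).mul_left (2 * (s : ℝ)))).add
      ((hasSum_poissonWeight s).mul_left ((s : ℝ) ^ 2))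
    convert h2 using 1
    · ext m; push_cast; ring
    · ring
  | undirected =>
    simp only [stepLaw, walkMean, sub_zero, integral_sq_srwLaw, smul_eq_mul]
    exact hasSum_poissonWeight_mul_natCast s

/-! ### The surprisal and its integrability. -/

/-- The surprisal `-log p_s(x)` of the rate-1 walk at time `s`. -/
noncomputable def surprisal (c : WalkKind) (s : ℝ≥0) (x : ℤ) : ℝ := -Real.log (walkPmf c s x)

lemma surprisal_nonneg (c : WalkKind) (s : ℝ≥0) (x : ℤ) : 0 ≤ surprisal c s x := by
  unfold surprisal
  have := Real.log_nonpos (walkPmf_nonneg c s x) (walkPmf_le_one c s x)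
  linarith

lemma log_factorial_le_sq (m : ℕ) : Real.log m.factorial ≤ (m : ℝ) ^ 2 := by
  rcases Nat.eq_zero_or_pos m with rfl | hm
  · simp
  have h1 : (m.factorial : ℝ) ≤ (m : ℝ) ^ m := by exact_mod_cast Nat.factorial_le_pow m
  calc Real.log m.factorial ≤ Real.log ((m : ℝ) ^ m) := Real.log_le_log (by positivity) h1
    _ = m * Real.log m := Real.log_pow _ _
    _ ≤ m * m := by
      gcongr
      have := Real.log_le_sub_one_of_pos (x := m) (by positivity)
      linarith
    _ = _ := by ring

/-- The second alternative covers unreachable points, where `Real.log 0 = 0` makes the surprisal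
vanish. -/
lemma surprisal_le (c : WalkKind) {s : ℝ≥0} (hs : 0 < s) (x : ℤ) :
    surprisal c s x ≤ s + x.natAbs * (Real.log 2 - Real.log s) + (x.natAbs : ℝ) ^ 2 ∨
      walkPmf c s x = 0 := by
  by_cases hx : reachable c x
  · left
    have hs' : (0 : ℝ) < s := hs
    have h := Real.log_le_log (by unfold poissonWeight; positivity) (le_walkPmf c s hx)
    unfold surprisal
    have h2 : Real.log (poissonWeight s x.natAbs * 2⁻¹ ^ x.natAbs)
        = -s + x.natAbs * Real.log s - Real.log (x.natAbs.factorial)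
          - x.natAbs * Real.log 2 := by
      unfold poissonWeight
      rw [Real.log_mul (by positivity) (by positivity), Real.log_div (by positivity)
        (by positivity), Real.log_mul (by positivity) (by positivity), Real.log_exp, Real.log_pow,
        Real.log_pow, Real.log_inv]
      ring
    have h3 := log_factorial_le_sq x.natAbs
    linarith
  · exact Or.inr (walkPmf_of_not_reachable c s hx)

/-- Uniformity over a compact time interval away from `0` is what dominated convergence in the time
variable requires. -/
lemma surprisal_le_of_mem_Icc (c : WalkKind) {a b s : ℝ≥0} (ha : 0 < a) (has : a ≤ s)
    (hsb : s ≤ b) (x : ℤ) :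
    surprisal c s x ≤ (b + Real.log 2 + |Real.log a| + 1) * (1 + (x.natAbs : ℝ) ^ 2) := by
  have ha' : (0 : ℝ) < a := ha
  have hb' : (0 : ℝ) ≤ b := b.2
  have hl2 : 0 ≤ Real.log 2 := Real.log_nonneg (by norm_num)
  have hn : (x.natAbs : ℝ) ≤ 1 + (x.natAbs : ℝ) ^ 2 := by
    nlinarith [sq_nonneg ((x.natAbs : ℝ) - 1)]
  rcases surprisal_le c (ha.trans_le has) x with h | h
  · have h1 : Real.log a ≤ Real.log s := Real.log_le_log ha' has
    have h2 := neg_abs_le (Real.log a)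
    have h3 : (s : ℝ) ≤ b := hsb
    have h4 : (x.natAbs : ℝ) * (Real.log 2 - Real.log s)
        ≤ (1 + (x.natAbs : ℝ) ^ 2) * (Real.log 2 + |Real.log a|) := by
      calc (x.natAbs : ℝ) * (Real.log 2 - Real.log s)
          ≤ x.natAbs * (Real.log 2 + |Real.log a|) := by gcongr; linarith
        _ ≤ _ := by gcongr
    nlinarith [sq_nonneg (x.natAbs : ℝ)]
  · rw [surprisal, h, Real.log_zero, neg_zero]
    positivity

lemma integrable_surprisal_pow (c : WalkKind) (s : ℝ≥0) (j : ℕ) :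
    Integrable (fun x => surprisal c s x ^ j) (rateOneLaw c s) := by
  rcases eq_or_lt_of_le (zero_le : 0 ≤ s) with rfl | hs
  · have : (fun x => surprisal c 0 x ^ j) =ᵐ[rateOneLaw c 0] fun _ => (0 : ℝ) ^ j := by
      have h1 : walkPmf c 0 0 = 1 :=
        le_antisymm (walkPmf_le_one _ _ _) (by simpa using exp_neg_le_walkPmf_zero c 0)
      have h2 : ∀ᵐ x ∂rateOneLaw c 0, x ∈ ({0} : Set ℤ) := by
        have h3 : rateOneLaw c 0 {0} = 1 := by
          rw [walkPmf, measureReal_def, ENNReal.toReal_eq_one_iff] at h1; exact h1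
        exact (prob_compl_eq_zero_iff (measurableSet_singleton _)).2 h3
      filter_upwards [h2] with x hx
      rw [Set.mem_singleton_iff.1 hx, surprisal, h1]; simp
    exact (integrable_congr this).2 (integrable_const _)
  · refine Integrable.mono' (g := fun x : ℤ =>
      ((s + Real.log 2 + |Real.log s| + 1) * (1 + (x.natAbs : ℝ) ^ 2)) ^ j) ?_ .of_discrete
      (ae_of_all _ fun x => ?_)
    · simp_rw [mul_pow, add_pow, one_pow, one_mul]
      refine Integrable.const_mul ?_ _
      refine integrable_finsetSum _ fun i _ => ?_
      refine Integrable.mul_const ?_ _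
      simp_rw [← pow_mul]
      exact integrable_natAbs_pow c s _
    · rw [Real.norm_of_nonneg (pow_nonneg (surprisal_nonneg c s x) _)]
      exact pow_le_pow_left₀ (surprisal_nonneg c s x)
        (surprisal_le_of_mem_Icc c hs le_rfl le_rfl x) _

/-! ### Characteristic functions and Fourier inversion. -/

/-- The characteristic function of one step of the walk. -/
noncomputable def stepChar : WalkKind → ℝ → ℂ
  | .directed, θ => Complex.exp (θ * Complex.I)
  | .undirected, θ => Complex.cos θ

/-- The mean of one step of the walk. -/
noncomputable def drift : WalkKind → ℝ
  | .directed => 1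
  | .undirected => 0

lemma walkMean_eq (c : WalkKind) (s : ℝ≥0) : walkMean c s = drift c * s := by
  cases c <;> simp [walkMean, drift]

lemma continuous_stepChar (c : WalkKind) : Continuous (stepChar c) := by
  cases c <;> unfold stepChar <;> fun_prop

/-- The modulus of the characteristic function of the walk depends only on this real part, so both
kinds of walk share every Fourier bound below. -/
lemma stepChar_re (c : WalkKind) (θ : ℝ) : (stepChar c θ).re = Real.cos θ := by
  cases c
  · simp [stepChar, Complex.exp_ofReal_mul_I_re]
  · simp [stepChar, ← Complex.ofReal_cos]

lemma integral_cexp_stepLaw (c : WalkKind) (m : ℕ) (θ : ℝ) :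
    ∫ x : ℤ, Complex.exp (x * (θ * Complex.I)) ∂(stepLaw c m) = stepChar c θ ^ m := by
  cases c with
  | directed =>
    simp only [stepLaw, stepChar, integral_dirac]
    rw [← Complex.exp_nat_mul]; simp
  | undirected =>
    simp only [stepLaw, stepChar]
    induction m with
    | zero => simp [srwLaw]
    | succ m ih =>
      rw [integral_srwLaw_succ m _ (fun m => integrable_srwLaw_complex m _), pow_succ, ← ih,
        ← smul_add, ← integral_add (integrable_srwLaw_complex m _) (integrable_srwLaw_complex m _),
        ← integral_smul, ← integral_mul_const]
      refine integral_congr_ae (ae_of_all _ fun x => ?_)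
      simp only [Complex.cos]
      push_cast
      rw [add_mul, sub_mul, Complex.exp_add, sub_eq_add_neg, Complex.exp_add]
      simp only [Complex.real_smul]
      push_cast
      ring_nf

lemma norm_cexp_int_mul (x : ℤ) (θ : ℝ) : ‖Complex.exp (x * (θ * Complex.I))‖ = 1 := by
  rw [← mul_assoc, ← Complex.ofReal_intCast, ← Complex.ofReal_mul, Complex.norm_exp_ofReal_mul_I]

lemma integrable_cexp_int_mul (μ : Measure ℤ) [IsFiniteMeasure μ] (θ : ℝ) :
    Integrable (fun x : ℤ => Complex.exp (x * (θ * Complex.I))) μ :=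
  (integrable_const (1 : ℝ)).mono' .of_discrete
    (ae_of_all _ fun x => (norm_cexp_int_mul x θ).le)

/-- The characteristic function of the rate-1 walk at time `s`. -/
noncomputable def walkChar (c : WalkKind) (s : ℝ≥0) (θ : ℝ) : ℂ :=
  Complex.exp (s * (stepChar c θ - 1))

lemma continuous_walkChar (c : WalkKind) (s : ℝ≥0) : Continuous (walkChar c s) := by
  have := continuous_stepChar c
  unfold walkChar; fun_prop

lemma walkChar_add (c : WalkKind) (s t : ℝ≥0) (θ : ℝ) :
    walkChar c (s + t) θ = walkChar c s θ * walkChar c t θ := by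
  unfold walkChar
  rw [← Complex.exp_add]; push_cast; ring_nf

lemma norm_walkChar (c : WalkKind) (s : ℝ≥0) (θ : ℝ) :
    ‖walkChar c s θ‖ = Real.exp (s * (Real.cos θ - 1)) := by
  unfold walkChar
  rw [Complex.norm_exp]
  congr 1
  have := stepChar_re c θ
  simp [Complex.mul_re, this]

lemma integral_cexp_rateOneLaw (c : WalkKind) (s : ℝ≥0) (θ : ℝ) :
    ∫ x : ℤ, Complex.exp (x * (θ * Complex.I)) ∂(rateOneLaw c s) = walkChar c s θ := by
  have h := hasSum_integral_stepLaw c s (integrable_cexp_int_mul (rateOneLaw c s) θ)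
  refine h.unique ?_
  simp_rw [integral_cexp_stepLaw]
  have h2 := (NormedSpace.expSeries_div_hasSum_exp ((s : ℂ) * stepChar c θ)).mul_left
    (Complex.exp (-s))
  rw [← Complex.exp_eq_exp_ℂ, ← Complex.exp_add] at h2
  have e1 : (fun m => poissonWeight s m • stepChar c θ ^ m)
      = fun m => Complex.exp (-s) * (((s : ℂ) * stepChar c θ) ^ m / (m.factorial : ℂ)) := by
    ext m
    simp only [poissonWeight, Complex.real_smul]
    push_cast
    rw [mul_pow]; ring
  have e2 : walkChar c s θ = Complex.exp (-s + s * stepChar c θ) := by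
    unfold walkChar; ring_nf
  rw [e1, e2]
  exact h2

lemma integral_cexp_int_period (n : ℤ) :
    ∫ θ in (-Real.pi)..Real.pi, Complex.exp (n * (θ * Complex.I))
      = if n = 0 then 2 * (Real.pi : ℂ) else 0 := by
  split_ifs with h
  · subst h; simp; ring
  · have h1 : (n : ℂ) * Complex.I ≠ 0 :=
      mul_ne_zero (by exact_mod_cast h) Complex.I_ne_zero
    have h2 := integral_exp_mul_complex (a := -Real.pi) (b := Real.pi) h1
    have h3 : ∀ θ : ℝ, Complex.exp (n * (θ * Complex.I))
        = Complex.exp ((n : ℂ) * Complex.I * θ) := fun θ => by ring_nf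
    simp_rw [h3]
    rw [h2, div_eq_zero_iff]
    left
    rw [sub_eq_zero, Complex.exp_eq_exp_iff_exists_int]
    exact ⟨n, by push_cast; ring⟩

lemma integral_walkChar_mul (c : WalkKind) (s : ℝ≥0) {g : ℝ → ℂ} (hg : Continuous g) :
    ∫ θ in (-Real.pi)..Real.pi, walkChar c s θ * g θ
      = ∫ y : ℤ, (∫ θ in (-Real.pi)..Real.pi, Complex.exp (y * (θ * Complex.I)) * g θ)
          ∂(rateOneLaw c s) := by
  simp_rw [← integral_cexp_rateOneLaw]
  rw [← intervalIntegral_integral_swap]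
  · simp_rw [integral_mul_const]
  · obtain ⟨C, hC⟩ := (isCompact_uIcc (a := -Real.pi) (b := Real.pi)).exists_bound_of_continuousOn
      hg.continuousOn
    have : IsFiniteMeasure (volume.restrict (Set.uIoc (-Real.pi) Real.pi)) :=
      ⟨by simp [Set.uIoc]⟩
    refine Integrable.mono' (integrable_const C) ?_ ?_
    · refine Measurable.aestronglyMeasurable ?_
      refine measurable_from_prod_countable_left fun y => ?_
      have : Continuous fun x : ℝ => Complex.exp (y * (x * Complex.I)) * g x := by fun_prop
      exact this.measurable
    · have : ∀ᵐ θ ∂(volume.restrict (Set.uIoc (-Real.pi) Real.pi)), ‖g θ‖ ≤ C := by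
        filter_upwards [ae_restrict_mem measurableSet_uIoc] with θ hθ
        exact hC θ (Set.uIoc_subset_uIcc hθ)
      have h2 := Measure.quasiMeasurePreserving_fst
        (μ := volume.restrict (Set.uIoc (-Real.pi) Real.pi)) (ν := rateOneLaw c s) |>.ae this
      filter_upwards [h2] with z hz
      simp only [Function.uncurry]
      rw [norm_mul, norm_cexp_int_mul, one_mul]
      exact hz

lemma walkPmf_eq_integral (c : WalkKind) (s : ℝ≥0) (x : ℤ) :
    (walkPmf c s x : ℂ) = (2 * (Real.pi : ℂ))⁻¹ *
      ∫ θ in (-Real.pi)..Real.pi, walkChar c s θ * Complex.exp (-x * (θ * Complex.I)) := by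
  rw [integral_walkChar_mul c s (by fun_prop)]
  have h : ∀ y : ℤ, ∫ θ in (-Real.pi)..Real.pi,
      Complex.exp (y * (θ * Complex.I)) * Complex.exp (-x * (θ * Complex.I))
        = ({x} : Set ℤ).indicator (fun _ => 2 * (Real.pi : ℂ)) y := by
    intro y
    have h1 := integral_cexp_int_period (y - x)
    simp_rw [← Complex.exp_add, ← add_mul, ← sub_eq_add_neg]
    push_cast at h1
    rw [h1]
    by_cases hxy : y = x
    · simp [hxy]
    · simp [hxy, sub_eq_zero]
  simp_rw [h]
  rw [integral_indicator_const _ (measurableSet_singleton x)]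
  have hpi : (Real.pi : ℂ) ≠ 0 := by exact_mod_cast Real.pi_ne_zero
  rw [Complex.real_smul, walkPmf]
  field_simp

/-! ### Semigroup property and regularity in time. -/

/-- Chapman–Kolmogorov, read off from the multiplicativity in time of the characteristic function
through Fourier inversion, which treats both kinds of walk at once. -/
lemma walkPmf_add (c : WalkKind) (s t : ℝ≥0) (x : ℤ) :
    walkPmf c (s + t) x = ∫ y, walkPmf c t (x - y) ∂(rateOneLaw c s) := by
  have h : (walkPmf c (s + t) x : ℂ) = ∫ y, (walkPmf c t (x - y) : ℂ) ∂(rateOneLaw c s) := by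
    rw [walkPmf_eq_integral]
    simp_rw [walkChar_add, mul_assoc]
    have hc : Continuous fun θ : ℝ => walkChar c t θ * Complex.exp (-x * (θ * Complex.I)) := by
      have := continuous_walkChar c t
      fun_prop
    rw [integral_walkChar_mul c s hc, ← integral_const_mul]
    refine integral_congr_ae (ae_of_all _ fun y => ?_)
    simp only
    rw [walkPmf_eq_integral]
    congr 1
    refine intervalIntegral.integral_congr fun θ _ => ?_
    rw [mul_left_comm, ← Complex.exp_add]
    push_cast
    ring_nf
  rw [integral_complex_ofReal] at h
  exact_mod_cast h

lemma hasSum_walkPmf_add (c : WalkKind) (s t : ℝ≥0) (x : ℤ) :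
    HasSum (fun y => walkPmf c s y * walkPmf c t (x - y)) (walkPmf c (s + t) x) := by
  rw [walkPmf_add]
  refine hasSum_integral_rateOneLaw c s ((integrable_const (1 : ℝ)).mono' .of_discrete
    (ae_of_all _ fun y => ?_))
  rw [Real.norm_of_nonneg (walkPmf_nonneg _ _ _)]
  exact walkPmf_le_one _ _ _

lemma walkPmf_mul_le (c : WalkKind) (s t : ℝ≥0) (x y : ℤ) :
    walkPmf c s y * walkPmf c t (x - y) ≤ walkPmf c (s + t) x :=
  le_hasSum (hasSum_walkPmf_add c s t x) y
    fun _ _ => mul_nonneg (walkPmf_nonneg _ _ _) (walkPmf_nonneg _ _ _)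

/-- A walk at `x` at time `s` can stay there until time `t`. This dominates all earlier mass
functions by a single one. -/
lemma walkPmf_le_exp_mul (c : WalkKind) {s t : ℝ≥0} (hst : s ≤ t) (x : ℤ) :
    walkPmf c s x ≤ Real.exp t * walkPmf c t x := by
  obtain ⟨r, rfl⟩ := exists_add_of_le hst
  have h := walkPmf_mul_le c s r x x
  rw [sub_self] at h
  have h2 := exp_neg_le_walkPmf_zero c r
  have h3 : walkPmf c s x * Real.exp (-r) ≤ walkPmf c (s + r) x :=
    (mul_le_mul_of_nonneg_left h2 (walkPmf_nonneg _ _ _)).trans h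
  have h4 : walkPmf c s x = Real.exp r * (walkPmf c s x * Real.exp (-r)) := by
    rw [mul_left_comm, ← Real.exp_add]; simp
  rw [h4]
  have h5 : Real.exp r ≤ Real.exp ((s + r : ℝ≥0) : ℝ) := by
    apply Real.exp_le_exp.2; push_cast; linarith [s.2]
  exact mul_le_mul h5 h3 (mul_nonneg (walkPmf_nonneg _ _ _) (Real.exp_nonneg _)) (Real.exp_nonneg _)

lemma continuous_walkPmf (c : WalkKind) (x : ℤ) : Continuous fun s => walkPmf c s x := by
  have h : Continuous fun s : ℝ≥0 => (2 * (Real.pi : ℂ))⁻¹ *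
      ∫ θ in (-Real.pi)..Real.pi, walkChar c s θ * Complex.exp (-x * (θ * Complex.I)) := by
    refine continuous_const.mul
      (intervalIntegral.continuous_parametric_intervalIntegral_of_continuous' ?_ _ _)
    have := continuous_stepChar c
    unfold Function.uncurry walkChar
    fun_prop
  simp_rw [← walkPmf_eq_integral] at h
  exact Complex.continuous_re.comp h |>.congr fun s => by simp

/-! ### Fourier bounds on the probability mass function. -/

lemma norm_stepChar_sub_le (c : WalkKind) {θ : ℝ} (hθ : |θ| ≤ 1) :
    ‖stepChar c θ - 1 - drift c * θ * Complex.I + θ ^ 2 / 2‖ ≤ |θ| ^ 3 := by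
  have key : ∀ θ : ℝ, |θ| ≤ 1 →
      ‖Complex.exp (θ * Complex.I) - 1 - θ * Complex.I + θ ^ 2 / 2‖ ≤ |θ| ^ 3 := by
    intro θ hθ
    have hn : ‖(θ : ℂ) * Complex.I‖ = |θ| := by simp
    have h := Complex.exp_bound (x := θ * Complex.I) (by rw [hn]; exact hθ) (n := 3) (by norm_num)
    rw [hn] at h
    have h2 : Complex.exp (θ * Complex.I)
        - ∑ m ∈ Finset.range 3, (θ * Complex.I) ^ m / (m.factorial : ℂ)
        = Complex.exp (θ * Complex.I) - 1 - θ * Complex.I + θ ^ 2 / 2 := by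
      simp [Finset.sum_range_succ, Nat.factorial, mul_pow]
      ring
    rw [h2] at h
    refine h.trans ?_
    have : 0 ≤ |θ| ^ 3 := by positivity
    norm_num [Nat.factorial]
    linarith
  cases c with
  | directed => simpa [stepChar, drift] using key θ hθ
  | undirected =>
    have h1 := key θ hθ
    have h2 := key (-θ) (by simpa using hθ)
    -- The cosine is the average of the exponentials at `θ` and `-θ`, so the linear terms cancel.
    have e : stepChar .undirected θ - 1 - drift .undirected * θ * Complex.I + θ ^ 2 / 2
        = ((Complex.exp (θ * Complex.I) - 1 - θ * Complex.I + θ ^ 2 / 2)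
          + (Complex.exp ((-θ : ℝ) * Complex.I) - 1 - (-θ : ℝ) * Complex.I + (-θ : ℝ) ^ 2 / 2))
            / 2 := by
      simp only [stepChar, drift, Complex.cos]; push_cast; ring
    rw [e, norm_div]
    rw [abs_neg] at h2
    have h3 := norm_add_le (Complex.exp (θ * Complex.I) - 1 - θ * Complex.I + θ ^ 2 / 2)
      (Complex.exp ((-θ : ℝ) * Complex.I) - 1 - (-θ : ℝ) * Complex.I + (-θ : ℝ) ^ 2 / 2)
    simp only [Complex.norm_ofNat]
    linarith

/-- The rescaled integrand in the Fourier inversion formula. -/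
noncomputable def scaledIntegrand (c : WalkKind) (s : ℝ≥0) (x : ℤ) (w : ℝ) : ℂ :=
  (Set.Ioc (-Real.pi * √s) (Real.pi * √s)).indicator
    (fun w => Complex.exp (s * (stepChar c (w / √s) - 1) - x * ((w / √s : ℝ) * Complex.I))) w

lemma sqrt_mul_walkPmf_eq (c : WalkKind) {s : ℝ≥0} (hs : 0 < s) (x : ℤ) :
    ((√s * walkPmf c s x : ℝ) : ℂ) = (2 * (Real.pi : ℂ))⁻¹ * ∫ w, scaledIntegrand c s x w := by
  have hs' : (0 : ℝ) < √s := Real.sqrt_pos.2 hs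
  have hpi := Real.pi_pos
  unfold scaledIntegrand
  rw [integral_indicator measurableSet_Ioc, ← intervalIntegral.integral_of_le (by nlinarith)]
  have h := intervalIntegral.integral_comp_div (a := -Real.pi * √s) (b := Real.pi * √s)
    (fun θ : ℝ => Complex.exp (s * (stepChar c θ - 1) - x * ((θ : ℝ) * Complex.I))) hs'.ne'
  rw [h, mul_div_cancel_right₀ _ hs'.ne', mul_div_cancel_right₀ _ hs'.ne', Complex.ofReal_mul,
    walkPmf_eq_integral, Complex.real_smul, mul_left_comm]
  congr 2
  refine intervalIntegral.integral_congr fun θ _ => ?_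
  simp only [walkChar]
  rw [← Complex.exp_add]
  ring_nf

/-- On `[-π, π]` one has `cos θ ≤ 1 - 2 θ² / π²`. The Gaussian bound does not depend on `s`: it
gives the bound `C / √s` on the mass function and the domination in the local limit theorem. -/
lemma norm_scaledIntegrand_le (c : WalkKind) {s : ℝ≥0} (hs : 0 < s) (x : ℤ) (w : ℝ) :
    ‖scaledIntegrand c s x w‖ ≤ Real.exp (-(2 / Real.pi ^ 2) * w ^ 2) := by
  have hs' : (0 : ℝ) < √s := Real.sqrt_pos.2 hs
  have hss : (s : ℝ) = √s ^ 2 := (Real.sq_sqrt s.2).symm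
  unfold scaledIntegrand
  rw [Set.indicator]
  split_ifs with h
  · rw [Complex.norm_exp]
    apply Real.exp_le_exp.2
    have hre : ((s : ℂ) * (stepChar c (w / √s) - 1) - x * ((w / √s : ℝ) * Complex.I)).re
        = s * (Real.cos (w / √s) - 1) := by
      have := stepChar_re c (w / √s)
      simp [Complex.mul_re, this]
    have hb : |w / √s| ≤ Real.pi := by
      rw [abs_div, abs_of_pos hs', div_le_iff₀ hs', abs_le]
      exact ⟨by linarith [h.1], h.2⟩
    have hcos := Real.cos_le_one_sub_mul_cos_sq hb
    refine hre.le.trans ?_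
    calc (s : ℝ) * (Real.cos (w / √s) - 1) ≤ s * (-(2 / Real.pi ^ 2 * (w / √s) ^ 2)) := by
          gcongr; linarith
      _ = _ := by rw [hss]; simp only [Real.sqrt_sq, Real.sqrt_nonneg]; field_simp
  · simpa using Real.exp_nonneg _

lemma integrable_exp_neg_pi_sq :
    Integrable fun w : ℝ => Real.exp (-(2 / Real.pi ^ 2) * w ^ 2) :=
  integrable_exp_neg_mul_sq (by have := Real.pi_pos; positivity)

/-- The constant in the uniform bound on the probability mass function. -/
noncomputable def pmfConst : ℝ :=
  (2 * Real.pi)⁻¹ * ∫ w : ℝ, Real.exp (-(2 / Real.pi ^ 2) * w ^ 2)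

lemma sqrt_mul_walkPmf_le (c : WalkKind) (s : ℝ≥0) (x : ℤ) : √s * walkPmf c s x ≤ pmfConst := by
  rcases eq_or_lt_of_le (zero_le : 0 ≤ s) with rfl | hs
  · simp only [NNReal.coe_zero, Real.sqrt_zero, zero_mul]
    have := Real.pi_pos
    exact mul_nonneg (by positivity) (integral_nonneg fun w => Real.exp_nonneg _)
  have h := congrArg norm (sqrt_mul_walkPmf_eq c hs x)
  rw [Complex.norm_real, Real.norm_of_nonneg
    (mul_nonneg (Real.sqrt_nonneg _) (walkPmf_nonneg _ _ _))] at h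
  rw [h, norm_mul, pmfConst]
  have hpi := Real.pi_pos
  have e : ‖(2 * (Real.pi : ℂ))⁻¹‖ = (2 * Real.pi)⁻¹ := by
    rw [norm_inv, norm_mul, Complex.norm_real, Real.norm_of_nonneg hpi.le]; simp
  rw [e]
  refine mul_le_mul_of_nonneg_left ?_ (by positivity)
  exact norm_integral_le_of_norm_le integrable_exp_neg_pi_sq
    (ae_of_all _ fun w => norm_scaledIntegrand_le c hs x w)

/-! ### Moments of the surprisal. -/

/-- The `j`-th moment of the surprisal of the rate-1 walk at time `s`. -/
noncomputable def surprisalMoment (c : WalkKind) (j : ℕ) (s : ℝ≥0) : ℝ :=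
  ∫ x, surprisal c s x ^ j ∂(rateOneLaw c s)

lemma hasSum_surprisalMoment (c : WalkKind) (j : ℕ) (s : ℝ≥0) :
    HasSum (fun x => walkPmf c s x * surprisal c s x ^ j) (surprisalMoment c j s) :=
  hasSum_integral_rateOneLaw c s (integrable_surprisal_pow c s j)

/-- The entropy of the rate-1 walk at time `s`. -/
noncomputable def walkEntropy (c : WalkKind) (s : ℝ≥0) : ℝ :=
  ∫ x, surprisal c s x ∂(rateOneLaw c s)

lemma walkEntropy_eq (c : WalkKind) (s : ℝ≥0) : walkEntropy c s = surprisalMoment c 1 s := by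
  simp [walkEntropy, surprisalMoment]

lemma hasSum_walkEntropy (c : WalkKind) (s : ℝ≥0) :
    HasSum (fun x => walkPmf c s x * surprisal c s x) (walkEntropy c s) := by
  simpa [walkEntropy_eq] using hasSum_surprisalMoment c 1 s

lemma walkEntropy_nonneg (c : WalkKind) (s : ℝ≥0) : 0 ≤ walkEntropy c s :=
  integral_nonneg fun x => surprisal_nonneg c s x

/-! ### Strict monotonicity of the entropy -/

/-- This is `log y ≤ y - 1` at `y = b / a`, multiplied by `a`. The extra `a - b` disappears after
summation over two probability vectors. -/
lemma gibbs_pointwise {a b : ℝ} (ha : 0 ≤ a) (hb : 0 ≤ b) (hab : 0 < a → 0 < b) :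
    a * -Real.log a + a - b ≤ a * -Real.log b ∧
      (a ≠ b → a * -Real.log a + a - b < a * -Real.log b) := by
  rcases eq_or_lt_of_le ha with rfl | ha'
  · simp only [zero_mul, zero_add, zero_sub]
    exact ⟨by linarith, fun h => by linarith [lt_of_le_of_ne hb h]⟩
  · have hb' := hab ha'
    have e : a * -Real.log b = a * -Real.log a - a * Real.log (b / a) := by
      rw [Real.log_div hb'.ne' ha'.ne']; ring
    have e2 : a * (b / a - 1) = b - a := by field_simp
    constructor
    · have := mul_le_mul_of_nonneg_left (Real.log_le_sub_one_of_pos (div_pos hb' ha')) ha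
      linarith
    · intro hne
      have hne' : b / a ≠ 1 := fun h => hne ((div_eq_one_iff_eq ha'.ne').1 h).symm
      have := mul_lt_mul_of_pos_left (Real.log_lt_sub_one_of_pos (div_pos hb' ha') hne') ha'
      linarith

/-- At `θ = π` the characteristic function has modulus `exp (-2 s)`, which determines `s`. -/
lemma walkPmf_injective (c : WalkKind) {s t : ℝ≥0} (h : walkPmf c s = walkPmf c t) : s = t := by
  have hs := hasSum_integral_rateOneLaw c s (integrable_cexp_int_mul (rateOneLaw c s) Real.pi)
  have ht := hasSum_integral_rateOneLaw c t (integrable_cexp_int_mul (rateOneLaw c t) Real.pi)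
  rw [h, integral_cexp_rateOneLaw] at hs
  rw [integral_cexp_rateOneLaw] at ht
  have h2 := congrArg norm (hs.unique ht)
  rw [norm_walkChar, norm_walkChar, Real.exp_eq_exp, Real.cos_pi] at h2
  exact NNReal.coe_injective (by linarith)

/-- The law at time `t = r + s` is the mixture, with weights `p_r(y)`, of the translates by `y` of
the law at time `s`. The cross-entropy of each translate against `p_t` is at least `h(s)` by Gibbs,
and the weighted cross-entropies add up to `h(t)`. Strictness comes from `y = 0`, which has positive
weight. -/
lemma walkEntropy_strictMono (c : WalkKind) : StrictMono (walkEntropy c) := by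
  intro s t hst
  obtain ⟨r, hr, rfl⟩ : ∃ r : ℝ≥0, 0 < r ∧ r + s = t :=
    ⟨t - s, tsub_pos_of_lt hst, tsub_add_cancel_of_le hst.le⟩
  set t := r + s with ht
  -- Summing `F` over `y` gives the terms of the entropy at time `t`; summing over `x` gives
  -- weighted cross-entropies. Nonnegativity allows the exchange.
  let F : ℤ × ℤ → ℝ := fun z => walkPmf c r z.2 * walkPmf c s (z.1 - z.2) * surprisal c t z.1
  have hF0 : ∀ z, 0 ≤ F z := fun z =>
    mul_nonneg (mul_nonneg (walkPmf_nonneg _ _ _) (walkPmf_nonneg _ _ _)) (surprisal_nonneg _ _ _)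
  have hrow : ∀ x, HasSum (fun y => F (x, y)) (walkPmf c t x * surprisal c t x) := fun x =>
    (hasSum_walkPmf_add c r s x).mul_right _
  have hsum : Summable F := by
    refine (summable_prod_of_nonneg hF0).2 ⟨fun x => (hrow x).summable, ?_⟩
    simp_rw [fun x => (hrow x).tsum_eq]
    exact (hasSum_walkEntropy c t).summable
  have htot : HasSum (fun y => ∑' x, F (x, y)) (walkEntropy c t) := by
    have h1 : ∑' y, ∑' x, F (x, y) = walkEntropy c t := by
      rw [← Summable.tsum_comm (f := fun y x => F (x, y))
        ((Equiv.prodComm ℤ ℤ).summable_iff.2 hsum)]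
      simp_rw [fun x => (hrow x).tsum_eq]
      exact (hasSum_walkEntropy c t).tsum_eq
    rw [← h1]
    exact Summable.hasSum (((Equiv.prodComm ℤ ℤ).summable_iff.2 hsum).prod)
  have hcol : ∀ y, Summable fun x => F (x, y) := fun y =>
    ((Equiv.prodComm ℤ ℤ).summable_iff.2 hsum).prod_factor y
  -- The correction `p_s(x - y) - p_t(x)` sums to zero over `x`.
  have hlow : ∀ y, HasSum (fun x => walkPmf c r y * (walkPmf c s (x - y) * surprisal c s (x - y)
      + walkPmf c s (x - y) - walkPmf c t x)) (walkPmf c r y * walkEntropy c s) := by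
    intro y
    have h1 := (Equiv.subRight y).hasSum_iff.2 (hasSum_walkEntropy c s)
    have h2 := (Equiv.subRight y).hasSum_iff.2 (hasSum_walkPmf c s)
    have h3 := ((h1.add h2).sub (hasSum_walkPmf c t)).mul_left (walkPmf c r y)
    simpa using h3
  have hpt : ∀ y x, walkPmf c r y * (walkPmf c s (x - y) * surprisal c s (x - y)
      + walkPmf c s (x - y) - walkPmf c t x) ≤ F (x, y) ∧ (0 < walkPmf c r y →
      walkPmf c s (x - y) ≠ walkPmf c t x → walkPmf c r y * (walkPmf c s (x - y) *
        surprisal c s (x - y) + walkPmf c s (x - y) - walkPmf c t x) < F (x, y)) := by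
    intro y x
    simp only [F]
    rw [mul_assoc]
    rcases eq_or_lt_of_le (walkPmf_nonneg c r y) with h0 | hpos
    · rw [← h0]; simp
    · have hab : 0 < walkPmf c s (x - y) → 0 < walkPmf c t x := fun h =>
        (mul_pos hpos h).trans_le (walkPmf_mul_le c r s x y)
      have hg := gibbs_pointwise (walkPmf_nonneg c s (x - y)) (walkPmf_nonneg c t x) hab
      exact ⟨mul_le_mul_of_nonneg_left hg.1 hpos.le,
        fun _ hne => mul_lt_mul_of_pos_left (hg.2 hne) hpos⟩
  have hle : ∀ y, walkPmf c r y * walkEntropy c s ≤ ∑' x, F (x, y) := fun y =>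
    hasSum_le (fun x => (hpt y x).1) (hlow y) (hcol y).hasSum
  have h0 : 0 < walkPmf c r 0 := walkPmf_pos c hr (reachable_zero c)
  obtain ⟨x, hx⟩ : ∃ x, walkPmf c s x ≠ walkPmf c t x := by
    by_contra! h
    exact hst.ne (walkPmf_injective c (funext h))
  have hlt : walkPmf c r 0 * walkEntropy c s < ∑' x, F (x, 0) :=
    hasSum_lt (fun x => (hpt 0 x).1) ((hpt 0 x).2 h0 (by simpa using hx)) (hlow 0) (hcol 0).hasSum
  have hl := (hasSum_walkPmf c r).mul_right (walkEntropy c s)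
  rw [one_mul] at hl
  exact hasSum_lt hle hlt hl htot

/-! ### Growth of the entropy -/

lemma pmfConst_pos : 0 < pmfConst := by
  have h := sqrt_mul_walkPmf_le .directed 1 0
  have h2 := exp_neg_le_walkPmf_zero .directed 1
  simp only [NNReal.coe_one, Real.sqrt_one, one_mul] at h
  exact (Real.exp_pos _).trans_le (h2.trans h)

lemma le_walkEntropy (c : WalkKind) {s : ℝ≥0} (hs : 0 < s) :
    Real.log √s - Real.log pmfConst ≤ walkEntropy c s := by
  have h := (hasSum_walkPmf c s).mul_right (Real.log √s - Real.log pmfConst)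
  rw [one_mul] at h
  refine hasSum_le (fun x => ?_) h (hasSum_walkEntropy c s)
  rcases eq_or_lt_of_le (walkPmf_nonneg c s x) with h0 | hpos
  · rw [← h0]; simp
  · refine mul_le_mul_of_nonneg_left ?_ hpos.le
    have hs' : (0 : ℝ) < √s := Real.sqrt_pos.2 hs
    have h1 := Real.log_le_log (mul_pos hs' hpos) (sqrt_mul_walkPmf_le c s x)
    rw [Real.log_mul hs'.ne' hpos.ne'] at h1
    unfold surprisal; linarith

lemma tendsto_walkEntropy_atTop (c : WalkKind) : Tendsto (walkEntropy c) atTop atTop := by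
  have h1 : Tendsto (fun s : ℝ≥0 => Real.log √s - Real.log pmfConst) atTop atTop :=
    tendsto_atTop_add_const_right _ _ (Real.tendsto_log_atTop.comp
      (Real.tendsto_sqrt_atTop.comp (NNReal.tendsto_coe_atTop.2 tendsto_id)))
  exact tendsto_atTop_mono' _ ((eventually_gt_atTop 0).mono fun s hs => le_walkEntropy c hs) h1

/-! ### Continuity -/

lemma continuousAt_surprisalMoment (c : WalkKind) (j : ℕ) {s : ℝ≥0} (hs : 0 < s) :
    ContinuousAt (surprisalMoment c j) s := by
  have e : surprisalMoment c j = fun s => ∑' x, walkPmf c s x * surprisal c s x ^ j :=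
    funext fun s => (hasSum_surprisalMoment c j s).tsum_eq.symm
  rw [e]
  have ha : 0 < s / 2 := by positivity
  have hb : s < s + 1 := lt_add_one s
  let B : ℝ := (s + 1 : ℝ≥0) + Real.log 2 + |Real.log (s / 2 : ℝ≥0)| + 1
  refine tendsto_tsum_of_dominated_convergence (bound := fun x : ℤ =>
    Real.exp (s + 1 : ℝ≥0) * (walkPmf c (s + 1) x * (B * (1 + (x.natAbs : ℝ) ^ 2)) ^ j)) ?_ ?_ ?_
  · refine Summable.mul_left _ ?_
    have hi : Integrable (fun x : ℤ => (B * (1 + (x.natAbs : ℝ) ^ 2)) ^ j)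
        (rateOneLaw c (s + 1)) := by
      simp_rw [mul_pow, add_pow, one_pow, one_mul]
      refine Integrable.const_mul ?_ _
      refine integrable_finsetSum _ fun i _ => ?_
      refine Integrable.mul_const ?_ _
      simp_rw [← pow_mul]
      exact integrable_natAbs_pow c _ _
    exact (hasSum_integral_rateOneLaw c _ hi).summable
  · intro x
    by_cases hx : reachable c x
    · have h1 : Tendsto (fun s => walkPmf c s x) (𝓝 s) (𝓝 (walkPmf c s x)) :=
        (continuous_walkPmf c x).tendsto s
      exact h1.mul ((h1.log (walkPmf_pos c hs hx).ne').neg.pow j)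
    · simp_rw [fun s => walkPmf_of_not_reachable c s hx, zero_mul]
      exact tendsto_const_nhds
  · have hev : ∀ᶠ r in 𝓝 s, s / 2 < r ∧ r < s + 1 :=
      (lt_mem_nhds (by exact half_lt_self hs)).and (gt_mem_nhds hb)
    filter_upwards [hev] with r hr x
    rw [Real.norm_of_nonneg (mul_nonneg (walkPmf_nonneg _ _ _)
      (pow_nonneg (surprisal_nonneg _ _ _) _)), ← mul_assoc]
    refine mul_le_mul (walkPmf_le_exp_mul c hr.2.le x) ?_ (pow_nonneg (surprisal_nonneg _ _ _) _)
      (mul_nonneg (Real.exp_nonneg _) (walkPmf_nonneg _ _ _))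
    exact pow_le_pow_left₀ (surprisal_nonneg _ _ _)
      (surprisal_le_of_mem_Icc c ha hr.1.le hr.2.le x) _

/-! ### Small times -/

/-- The expectation is split by the number of jumps: none contributes at most `s ^ j`, one
contributes the main term of order `s (log (1/s)) ^ j`, and two or more carry a factor `s ^ 2`. -/
lemma surprisalMoment_le (c : WalkKind) (j : ℕ) {s : ℝ≥0} (hs : 0 < s) (hs1 : s ≤ 1) :
    surprisalMoment c j s ≤ (s : ℝ) ^ j + (-Real.log s + (Real.log 2 + 2)) ^ j *
      (s + s ^ 2 * ∑' m : ℕ, (m : ℝ) ^ (2 * j) / m.factorial) := by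
  have hs' : (0 : ℝ) < s := hs
  have hs1' : (s : ℝ) ≤ 1 := hs1
  have hl2 : 0 ≤ Real.log 2 := Real.log_nonneg (by norm_num)
  have hL : 0 ≤ -Real.log s := by linarith [Real.log_nonpos hs'.le hs1']
  -- In the `2`, one unit absorbs the summand `s ≤ 1` of `surprisal_le` and the other its quadratic
  -- term, so that the surprisal is at most `A x²` for `x ≠ 0`.
  set A : ℝ := -Real.log s + (Real.log 2 + 2) with hA
  have hsA : (s : ℝ) ≤ A := by linarith
  have hA0 : 0 ≤ A := by linarith
  let g : ℕ → ℝ := fun m => if m = 0 then (s : ℝ) ^ j else (A * (m : ℝ) ^ 2) ^ j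
  have hg0 : ∀ m, 0 ≤ g m := by
    intro m; simp only [g]; split_ifs <;> positivity
  have hgm : Monotone g := by
    refine monotone_nat_of_le_succ fun m => ?_
    simp only [g]
    rw [if_neg (Nat.succ_ne_zero m)]
    split_ifs with h
    · refine pow_le_pow_left₀ hs'.le ?_ j
      subst h; simpa using hsA
    · gcongr; exact Nat.le_succ m
  have hfg : ∀ x, |surprisal c s x ^ j| ≤ g x.natAbs := by
    intro x
    rw [abs_of_nonneg (pow_nonneg (surprisal_nonneg _ _ _) _)]
    simp only [g]
    split_ifs with h
    · refine pow_le_pow_left₀ (surprisal_nonneg _ _ _) ?_ _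
      rcases surprisal_le c hs x with h1 | h1
      · simpa [h] using h1
      · rw [surprisal, h1]; simp
    · refine pow_le_pow_left₀ (surprisal_nonneg _ _ _) ?_ _
      have hn : (1 : ℝ) ≤ x.natAbs := by exact_mod_cast Nat.one_le_iff_ne_zero.2 h
      rcases surprisal_le c hs x with h1 | h1
      · have : (x.natAbs : ℝ) ≤ (x.natAbs : ℝ) ^ 2 := by nlinarith
        have h3 := mul_le_mul_of_nonneg_right this
          (by linarith : 0 ≤ Real.log 2 - Real.log s)
        nlinarith
      · rw [surprisal, h1]; simp; positivity
  have hbase : Summable fun m : ℕ => (m : ℝ) ^ (2 * j) / m.factorial := by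
    have h := (summable_poissonWeight_mul_pow 1 (2 * j)).mul_left (Real.exp 1)
    refine h.congr fun m => ?_
    simp only [poissonWeight, NNReal.coe_one, one_pow, mul_one, Real.exp_neg]
    field_simp
  let b : ℕ → ℝ := fun m => (if m = 0 then (s : ℝ) ^ j else 0) +
    ((if m = 1 then A ^ j * s else 0) + A ^ j * s ^ 2 * ((m : ℝ) ^ (2 * j) / m.factorial))
  have hb : HasSum b ((s : ℝ) ^ j + (A ^ j * s + A ^ j * s ^ 2 *
      ∑' m : ℕ, (m : ℝ) ^ (2 * j) / m.factorial)) :=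
    (hasSum_ite_eq 0 _).add ((hasSum_ite_eq 1 _).add (hbase.hasSum.mul_left _))
  have hwb : ∀ m, poissonWeight s m * g m ≤ b m := by
    intro m
    have he : Real.exp (-s) ≤ 1 := Real.exp_le_one_iff.2 (by linarith)
    rcases Nat.eq_zero_or_pos m with rfl | hm
    · have : poissonWeight s 0 ≤ 1 := by simp [poissonWeight]
      simp only [g, b, if_true]
      have h1 := mul_le_mul_of_nonneg_right this (pow_nonneg hs'.le j)
      have : 0 ≤ A ^ j * s ^ 2 * (((0 : ℕ) : ℝ) ^ (2 * j) / (Nat.factorial 0)) := by positivity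
      simp only [zero_ne_one, if_false]
      linarith
    · simp only [g, b, hm.ne', if_false]
      rw [mul_pow, ← pow_mul]
      by_cases h1 : m = 1
      · subst h1
        simp only [if_true, poissonWeight, Nat.factorial_one, Nat.cast_one, one_pow, mul_one,
          pow_one, div_one, zero_add]
        have h2 : Real.exp (-s) * s ≤ 1 * s := mul_le_mul_of_nonneg_right he hs'.le
        have h3 := mul_le_mul_of_nonneg_right h2 (pow_nonneg hA0 j)
        have : 0 ≤ A ^ j * (s : ℝ) ^ 2 := by positivity
        linarith
      · simp only [h1, if_false, zero_add]
        have hm2 : 2 ≤ m := by omega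
        have h2 : (s : ℝ) ^ m ≤ s ^ 2 := pow_le_pow_of_le_one hs'.le hs1' hm2
        unfold poissonWeight
        calc Real.exp (-s) * (s : ℝ) ^ m / m.factorial * (A ^ j * (m : ℝ) ^ (2 * j))
            ≤ 1 * (s : ℝ) ^ 2 / m.factorial * (A ^ j * (m : ℝ) ^ (2 * j)) := by gcongr
          _ = _ := by ring
  have hsum : Summable fun m => poissonWeight s m * g m :=
    Summable.of_nonneg_of_le (fun m => mul_nonneg (poissonWeight_nonneg _ _) (hg0 m)) hwb
      hb.summable
  have h1 := (integrable_of_abs_le (c := c) hgm hg0 hfg hsum).2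
  have h2 : surprisalMoment c j s = ∫ x, |surprisal c s x ^ j| ∂(rateOneLaw c s) := by
    unfold surprisalMoment
    congr 1; ext x
    rw [abs_of_nonneg (pow_nonneg (surprisal_nonneg _ _ _) _)]
  rw [h2]
  refine h1.trans ((hasSum_le hwb hsum.hasSum hb).trans (le_of_eq ?_))
  ring

lemma stepLaw_one_zero (c : WalkKind) : stepLaw c 1 {0} = 0 := by
  cases c with
  | directed => simp [stepLaw]
  | undirected =>
    simp only [stepLaw, srwLaw, Measure.add_apply, Measure.smul_apply, smul_eq_mul]
    rw [Measure.map_apply (by fun_prop) (by measurability),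
      Measure.map_apply (by fun_prop) (by measurability)]
    simp

lemma walkPmf_zero_le (c : WalkKind) (s : ℝ≥0) :
    walkPmf c s 0 ≤ 1 - s * Real.exp (-s) := by
  have h : ENNReal.ofReal (poissonWeight s 1) ≤ rateOneLaw c s {0}ᶜ := by
    rw [← lintegral_indicator_one (μ := rateOneLaw c s) (measurableSet_singleton _).compl,
      lintegral_rateOneLaw]
    refine le_trans (le_of_eq ?_) (ENNReal.le_tsum 1)
    rw [lintegral_indicator_one (measurableSet_singleton _).compl,
      (prob_compl_eq_one_iff (measurableSet_singleton _)).2 (stepLaw_one_zero c), mul_one]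
  have h2 := ENNReal.toReal_mono (measure_ne_top _ _) h
  rw [ENNReal.toReal_ofReal (poissonWeight_nonneg _ _), ← measureReal_def,
    measureReal_compl (measurableSet_singleton _)] at h2
  simp only [probReal_univ, poissonWeight, pow_one, Nat.factorial_one, Nat.cast_one, div_one] at h2
  unfold walkPmf; linarith

lemma walkPmf_le_of_ne_zero (c : WalkKind) (s : ℝ≥0) {x : ℤ} (hx : x ≠ 0) :
    walkPmf c s x ≤ s := by
  have h := sum_le_hasSum {0, x} (fun i _ => walkPmf_nonneg c s i) (hasSum_walkPmf c s)
  rw [Finset.sum_pair hx.symm] at h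
  have h2 := exp_neg_le_walkPmf_zero c s
  have h3 := Real.add_one_le_exp (-(s : ℝ))
  linarith

/-- Away from `0` every atom has mass at most `s`, hence surprisal at least `log (1/s)`, and the
total mass there is at least the probability `s exp (-s)` of a single jump. -/
lemma le_surprisalMoment (c : WalkKind) (j : ℕ) {s : ℝ≥0} (hs : 0 < s) (hs1 : s ≤ 1) :
    (-Real.log s) ^ j * (s * Real.exp (-s)) ≤ surprisalMoment c j s := by
  have hs' : (0 : ℝ) < s := hs
  have hL : 0 ≤ -Real.log s := by linarith [Real.log_nonpos hs'.le (by exact_mod_cast hs1)]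
  have h1 : HasSum (fun x => (walkPmf c s x - if x = 0 then walkPmf c s 0 else 0)
      * (-Real.log s) ^ j) ((1 - walkPmf c s 0) * (-Real.log s) ^ j) :=
    ((hasSum_walkPmf c s).sub (hasSum_ite_eq 0 _)).mul_right _
  have h2 := hasSum_le (fun x => ?_) h1 (hasSum_surprisalMoment c j s)
  · refine le_trans ?_ h2
    rw [mul_comm]
    exact mul_le_mul_of_nonneg_right (by linarith [walkPmf_zero_le c s]) (pow_nonneg hL j)
  · by_cases hx : x = 0
    · subst hx
      simp only [if_true, sub_self, zero_mul]
      exact mul_nonneg (walkPmf_nonneg _ _ _) (pow_nonneg (surprisal_nonneg _ _ _) _)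
    · simp only [hx, if_false, sub_zero]
      rcases eq_or_lt_of_le (walkPmf_nonneg c s x) with h0 | hpos
      · rw [← h0]; simp
      · refine mul_le_mul_of_nonneg_left (pow_le_pow_left₀ hL ?_ _) hpos.le
        unfold surprisal
        exact neg_le_neg (Real.log_le_log hpos (walkPmf_le_of_ne_zero c s hx))

lemma tendsto_neg_log_nhdsGT : Tendsto (fun s : ℝ≥0 => -Real.log s) (𝓝[>] 0) atTop := by
  refine tendsto_neg_atBot_atTop.comp (Real.tendsto_log_nhdsGT_zero.comp ?_)
  refine tendsto_nhdsWithin_iff.2 ⟨?_, ?_⟩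
  · exact (NNReal.continuous_coe.tendsto 0).mono_left nhdsWithin_le_nhds
  · filter_upwards [self_mem_nhdsWithin] with s hs
    exact hs

lemma tendsto_coe_nhdsGT_zero : Tendsto (fun s : ℝ≥0 => (s : ℝ)) (𝓝[>] 0) (𝓝 0) :=
  (NNReal.continuous_coe.tendsto 0).mono_left nhdsWithin_le_nhds

lemma eventually_small_time : ∀ᶠ s : ℝ≥0 in 𝓝[>] 0, 0 < s ∧ s < 1 :=
  (eventually_mem_nhdsWithin).and (mem_nhdsWithin_of_mem_nhds (gt_mem_nhds one_pos))

lemma tendsto_surprisalMoment_div (c : WalkKind) {j : ℕ} (hj : 1 ≤ j) :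
    Tendsto (fun s : ℝ≥0 => surprisalMoment c j s / (s * (-Real.log s) ^ j)) (𝓝[>] 0) (𝓝 1) := by
  set K : ℝ := ∑' m : ℕ, (m : ℝ) ^ (2 * j) / m.factorial
  have hs0 := tendsto_coe_nhdsGT_zero
  have hLinv : Tendsto (fun s : ℝ≥0 => (-Real.log s)⁻¹) (𝓝[>] 0) (𝓝 0) :=
    tendsto_inv_atTop_zero.comp tendsto_neg_log_nhdsGT
  have hlow : Tendsto (fun s : ℝ≥0 => Real.exp (-(s : ℝ))) (𝓝[>] 0) (𝓝 1) := by
    have := (Real.continuous_exp.tendsto 0).comp (by simpa using hs0.neg :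
      Tendsto (fun s : ℝ≥0 => -(s : ℝ)) (𝓝[>] 0) (𝓝 0))
    simpa [Function.comp_def] using this
  have hup : Tendsto (fun s : ℝ≥0 => (s : ℝ) ^ (j - 1) * ((-Real.log s)⁻¹) ^ j +
      (1 + (Real.log 2 + 2) * (-Real.log s)⁻¹) ^ j * (1 + s * K)) (𝓝[>] 0) (𝓝 1) := by
    have := ((hs0.pow (j - 1)).mul (hLinv.pow j)).add
      (((hLinv.const_mul (Real.log 2 + 2)).const_add 1).pow j |>.mul
        ((hs0.mul_const K).const_add 1))
    have hj0 : j ≠ 0 := by omega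
    simpa [hj0] using this
  refine tendsto_of_tendsto_of_tendsto_of_le_of_le' hlow hup ?_ ?_
  · filter_upwards [eventually_small_time] with s hs
    have hs' : (0 : ℝ) < s := hs.1
    have hL : 0 < -Real.log s := by linarith [Real.log_neg hs' (by exact_mod_cast hs.2)]
    rw [le_div_iff₀ (by positivity)]
    have := le_surprisalMoment c j hs.1 hs.2.le
    linarith
  · filter_upwards [eventually_small_time] with s hs
    have hs' : (0 : ℝ) < s := hs.1
    have hL : 0 < -Real.log s := by linarith [Real.log_neg hs' (by exact_mod_cast hs.2)]
    rw [div_le_iff₀ (by positivity)]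
    refine (surprisalMoment_le c j hs.1 hs.2.le).trans (le_of_eq ?_)
    obtain ⟨i, rfl⟩ : ∃ i, j = i + 1 := ⟨j - 1, by omega⟩
    set L := -Real.log s
    have e : (1 + (Real.log 2 + 2) * L⁻¹) ^ (i + 1) * L ^ (i + 1)
        = (L + (Real.log 2 + 2)) ^ (i + 1) := by
      rw [← mul_pow]; congr 1; field_simp
    have e2 : (L⁻¹) ^ (i + 1) * L ^ (i + 1) = 1 := by
      rw [← mul_pow, inv_mul_cancel₀ hL.ne', one_pow]
    rw [← e, Nat.add_sub_cancel]
    linear_combination (-(s : ℝ) ^ (i + 1)) * e2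

lemma tendsto_mul_neg_log_nhdsGT :
    Tendsto (fun s : ℝ≥0 => (s : ℝ) * -Real.log s) (𝓝[>] 0) (𝓝 0) := by
  have h := (Real.continuous_mul_log.tendsto 0).comp tendsto_coe_nhdsGT_zero
  simpa [Function.comp_def] using h.neg

lemma walkEntropy_zero (c : WalkKind) : walkEntropy c 0 = 0 := by
  have h : ∀ x, walkPmf c 0 x * surprisal c 0 x = 0 := by
    intro x
    by_cases hx : x = 0
    · subst hx
      have : walkPmf c 0 0 = 1 :=
        le_antisymm (walkPmf_le_one _ _ _) (by simpa using exp_neg_le_walkPmf_zero c 0)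
      simp [surprisal, this]
    · have := le_antisymm (walkPmf_le_of_ne_zero c 0 hx) (walkPmf_nonneg _ _ _)
      simp [this]
  have h2 := hasSum_walkEntropy c 0
  simp_rw [h] at h2
  exact h2.unique hasSum_zero

lemma continuous_walkEntropy (c : WalkKind) : Continuous (walkEntropy c) := by
  rw [continuous_iff_continuousAt]
  intro s
  rcases eq_or_lt_of_le (zero_le : 0 ≤ s) with rfl | hs
  -- The quadratic bound on the surprisal degenerates at time `0`; there the asymptotics `h(s) ~ s
  -- log (1/s)` is used instead.
  · have h : Tendsto (walkEntropy c) (𝓝[>] 0) (𝓝 0) := by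
      have h1 := (tendsto_surprisalMoment_div c le_rfl).mul tendsto_mul_neg_log_nhdsGT
      rw [mul_zero] at h1
      refine h1.congr' ?_
      filter_upwards [eventually_small_time] with s hs
      have hs' : (0 : ℝ) < s := hs.1
      have hL : 0 < -Real.log s := by linarith [Real.log_neg hs' (by exact_mod_cast hs.2)]
      rw [walkEntropy_eq, pow_one, div_mul_cancel₀ _ (by positivity)]
    rw [continuousAt_iff_punctured_nhds]
    have : (𝓝[≠] (0 : ℝ≥0)) = 𝓝[>] 0 := by
      congr 1; ext x; simp [pos_iff_ne_zero]
    rw [this, walkEntropy_zero]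
    exact h
  · have : walkEntropy c = surprisalMoment c 1 := funext (walkEntropy_eq c)
    rw [this]
    exact continuousAt_surprisalMoment c 1 hs

/-- The entropy of the rate-1 walk as a homeomorphism of the half-line. -/
noncomputable def entropyHomeo (c : WalkKind) : ℝ≥0 ≃ₜ ℝ≥0 :=
  (StrictMono.orderIsoOfSurjective (β := ℝ≥0) (fun s => ⟨walkEntropy c s, walkEntropy_nonneg c s⟩)
    (fun _ _ h => walkEntropy_strictMono c h)
    (by
      intro y
      obtain ⟨T, hT⟩ := ((tendsto_walkEntropy_atTop c).eventually_ge_atTop (y : ℝ)).exists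
      have h := intermediate_value_Icc (zero_le : (0 : ℝ≥0) ≤ T)
        (continuous_walkEntropy c).continuousOn
      obtain ⟨s, -, hs⟩ := h ⟨by rw [walkEntropy_zero]; exact y.2, hT⟩
      exact ⟨s, NNReal.eq hs⟩)).toHomeomorph

lemma coe_entropyHomeo (c : WalkKind) (s : ℝ≥0) : (entropyHomeo c s : ℝ) = walkEntropy c s := rfl

/-! ### Decay of the probability mass function -/

lemma hasSum_walkPmf_mul_sq (c : WalkKind) (s : ℝ≥0) :
    HasSum (fun x => walkPmf c s x * ((x : ℝ) - walkMean c s) ^ 2) s := by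
  have h := hasSum_integral_rateOneLaw c s (integrable_sub_sq c s (walkMean c s))
  rwa [integral_sub_walkMean_sq] at h

/-- Time is cut into two equal halves. The squared deviation is at most twice the sum of the squared
deviations of the halves; in each term the mass of the other half is bounded by `C / √s`, and the
remaining sum is the variance `s`. -/
lemma sq_mul_walkPmf_add_self_le (c : WalkKind) {s : ℝ≥0} (hs : 0 < s) (x : ℤ) :
    ((x : ℝ) - walkMean c (s + s)) ^ 2 * walkPmf c (s + s) x ≤ 4 * pmfConst * √s := by
  have hs' : (0 : ℝ) < √s := Real.sqrt_pos.2 hs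
  have hC : ∀ y, walkPmf c s y ≤ pmfConst / √s := fun y => by
    rw [le_div_iff₀ hs', mul_comm]; exact sqrt_mul_walkPmf_le c s y
  have h1 := (hasSum_walkPmf_add c s s x).mul_left (((x : ℝ) - walkMean c (s + s)) ^ 2)
  have h2 := hasSum_walkPmf_mul_sq c s
  have h3 := (Equiv.subLeft x).hasSum_iff.2 h2
  have h4 := (h2.add h3).mul_left (2 * (pmfConst / √s))
  have h5 := hasSum_le (fun y => ?_) h1 h4
  · refine h5.trans (le_of_eq ?_)
    have : (s : ℝ) = √s * √s := (Real.mul_self_sqrt s.2).symm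
    field_simp
    rw [pow_two, ← this]; ring
  · simp only [Function.comp, Equiv.subLeft_apply]
    have e : walkMean c (s + s) = walkMean c s + walkMean c s := by
      rw [walkMean_eq, walkMean_eq]; push_cast; ring
    rw [e]
    set a := walkMean c s
    have hp := walkPmf_nonneg c s y
    have hq := walkPmf_nonneg c s (x - y)
    have hsq : ((x : ℝ) - (a + a)) ^ 2 ≤ 2 * (((y : ℝ) - a) ^ 2 + (((x - y : ℤ) : ℝ) - a) ^ 2) := by
      push_cast
      nlinarith [sq_nonneg (((y : ℝ) - a) - (((x : ℝ) - y) - a))]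
    calc ((x : ℝ) - (a + a)) ^ 2 * (walkPmf c s y * walkPmf c s (x - y))
        ≤ 2 * (((y : ℝ) - a) ^ 2 + (((x - y : ℤ) : ℝ) - a) ^ 2) *
            (walkPmf c s y * walkPmf c s (x - y)) := by gcongr
      _ = 2 * (walkPmf c s (x - y) * (walkPmf c s y * ((y : ℝ) - a) ^ 2)
            + walkPmf c s y * (walkPmf c s (x - y) * (((x - y : ℤ) : ℝ) - a) ^ 2)) := by ring
      _ ≤ 2 * (pmfConst / √s * (walkPmf c s y * ((y : ℝ) - a) ^ 2)
            + pmfConst / √s * (walkPmf c s (x - y) * (((x - y : ℤ) : ℝ) - a) ^ 2)) := by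
          gcongr
          · exact hC _
          · exact hC _
      _ = _ := by ring

lemma sqrt_mul_walkPmf_mul_le (c : WalkKind) {s : ℝ≥0} (hs : 0 < s) (x : ℤ) :
    √s * walkPmf c s x * (1 + ((x : ℝ) - walkMean c s) ^ 2 / s) ≤ 5 * pmfConst := by
  have hs' : (0 : ℝ) < s := hs
  have h1 := sqrt_mul_walkPmf_le c s x
  have h2 := sq_mul_walkPmf_add_self_le c (half_pos hs) x
  rw [add_halves] at h2
  have h3 : √((s / 2 : ℝ≥0) : ℝ) ≤ √s := by
    apply Real.sqrt_le_sqrt; push_cast; linarith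
  have h4 : ((x : ℝ) - walkMean c s) ^ 2 * walkPmf c s x ≤ 4 * pmfConst * √s :=
    h2.trans (mul_le_mul_of_nonneg_left h3 (by linarith [pmfConst_pos]))
  have h5 : √s * walkPmf c s x * (((x : ℝ) - walkMean c s) ^ 2 / s) ≤ 4 * pmfConst := by
    rw [mul_div_assoc', div_le_iff₀ hs']
    have : (s : ℝ) = √s * √s := (Real.mul_self_sqrt s.2).symm
    calc √s * walkPmf c s x * ((x : ℝ) - walkMean c s) ^ 2
        = √s * (((x : ℝ) - walkMean c s) ^ 2 * walkPmf c s x) := by ring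
      _ ≤ √s * (4 * pmfConst * √s) := by gcongr
      _ = 4 * pmfConst * (√s * √s) := by ring
      _ = _ := by rw [← this]
  linarith

/-! ### The rescaled density -/

/-- The lattice site at rescaled position `u`. -/
noncomputable def scaledSite (c : WalkKind) (s : ℝ≥0) (u : ℝ) : ℤ := ⌊walkMean c s + √s * u⌋

/-- The law of the rescaled walk, as a step density on the line. -/
noncomputable def scaledDensity (c : WalkKind) (s : ℝ≥0) (u : ℝ) : ℝ :=
  √s * walkPmf c s (scaledSite c s u)

lemma scaledDensity_nonneg (c : WalkKind) (s : ℝ≥0) (u : ℝ) : 0 ≤ scaledDensity c s u :=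
  mul_nonneg (Real.sqrt_nonneg _) (walkPmf_nonneg _ _ _)

lemma measurable_scaledSite (c : WalkKind) (s : ℝ≥0) : Measurable (scaledSite c s) := by
  unfold scaledSite; fun_prop

lemma measurable_scaledDensity (c : WalkKind) (s : ℝ≥0) : Measurable (scaledDensity c s) :=
  (Measurable.of_discrete (f := fun x => √s * walkPmf c s x)).comp (measurable_scaledSite c s)

/-- An integrable envelope valid for all `s ≥ 1` at once. The factor `15` is the `5` of
`sqrt_mul_walkPmf_mul_le` times `3`, the cost of rounding to the lattice. -/
lemma scaledDensity_le (c : WalkKind) {s : ℝ≥0} (hs : 1 ≤ s) (u : ℝ) :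
    scaledDensity c s u ≤ 15 * pmfConst * (1 + u ^ 2)⁻¹ := by
  have hs0 : 0 < s := zero_lt_one.trans_le hs
  have hs' : (0 : ℝ) < √s := Real.sqrt_pos.2 hs0
  have hs1 : (1 : ℝ) ≤ s := hs
  have h := sqrt_mul_walkPmf_mul_le c hs0 (scaledSite c s u)
  set x := scaledSite c s u with hx
  have hss : (s : ℝ) = √s * √s := (Real.mul_self_sqrt s.2).symm
  have hx1 : (x : ℝ) ≤ walkMean c s + √s * u := Int.floor_le _
  have hx2 : walkMean c s + √s * u < x + 1 := Int.lt_floor_add_one _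
  set d := (x : ℝ) - walkMean c s
  have hu : u ^ 2 ≤ 2 * (d ^ 2 / s) + 2 := by
    have : (√s * u) ^ 2 ≤ 2 * d ^ 2 + 2 := by nlinarith [sq_nonneg (2 * d - √s * u)]
    rw [mul_div_assoc', ← sub_le_iff_le_add, le_div_iff₀ (by linarith)]
    have e : (√s * u) ^ 2 = s * u ^ 2 := by rw [mul_pow, pow_two, ← hss]
    nlinarith
  rw [← div_eq_mul_inv, le_div_iff₀ (by positivity)]
  have hd : 0 ≤ d ^ 2 / (s : ℝ) := by positivity
  have h6 : 1 + u ^ 2 ≤ 3 * (1 + d ^ 2 / s) := by linarith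
  calc scaledDensity c s u * (1 + u ^ 2) ≤ scaledDensity c s u * (3 * (1 + d ^ 2 / s)) :=
        mul_le_mul_of_nonneg_left h6 (scaledDensity_nonneg c s u)
    _ = 3 * (√s * walkPmf c s x * (1 + d ^ 2 / s)) := by rw [scaledDensity]; ring
    _ ≤ _ := by linarith

/-- Sums over the lattice become integrals over the line, where densities at different times can be
compared pointwise. -/
lemma map_floor_volume : (volume : Measure ℝ).map Int.floor = (Measure.count : Measure ℤ) := by
  refine Measure.ext_of_singleton fun x => ?_
  rw [Measure.map_apply Int.measurable_floor (measurableSet_singleton x),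
    Int.preimage_floor_singleton, Measure.count_singleton]
  simp

lemma integral_comp_scaledSite (c : WalkKind) {s : ℝ≥0} (hs : 0 < s) (G : ℤ → ℝ) :
    √s * ∫ u, G (scaledSite c s u) = ∫ x, G x ∂Measure.count := by
  have hs' : (0 : ℝ) < √s := Real.sqrt_pos.2 hs
  have h1 := Measure.integral_comp_mul_left (fun y => G ⌊walkMean c s + y⌋) √s
  have h2 := integral_add_left_eq_self (μ := volume) (fun y : ℝ => G ⌊y⌋) (walkMean c s)
  unfold scaledSite
  rw [h1, h2, ← map_floor_volume, integral_map Int.measurable_floor.aemeasurable .of_discrete,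
    abs_of_pos (inv_pos.2 hs'), smul_eq_mul, mul_inv_cancel_left₀ hs'.ne']

lemma integrable_surprisal_sub_pow (c : WalkKind) (s : ℝ≥0) (l : ℝ) (j : ℕ) :
    Integrable (fun x => (surprisal c s x - l) ^ j) (rateOneLaw c s) := by
  simp_rw [sub_eq_add_neg, add_pow]
  refine integrable_finsetSum _ fun i _ => ?_
  exact ((integrable_surprisal_pow c s i).mul_const _).mul_const _

lemma integral_surprisal_sub_pow (c : WalkKind) {s : ℝ≥0} (hs : 0 < s) (j : ℕ) :
    ∫ x, (surprisal c s x - Real.log √s) ^ j ∂(rateOneLaw c s)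
      = ∫ u, scaledDensity c s u * (-Real.log (scaledDensity c s u)) ^ j := by
  have hs' : (0 : ℝ) < √s := Real.sqrt_pos.2 hs
  have hi := integrable_surprisal_sub_pow c s (Real.log √s) j
  have h1 := integral_comp_scaledSite c hs
    (fun x => walkPmf c s x * (surprisal c s x - Real.log √s) ^ j)
  have h2 : Integrable (fun x => walkPmf c s x * (surprisal c s x - Real.log √s) ^ j)
      Measure.count := by
    rw [integrable_count_iff]
    refine ((integrable_rateOneLaw_iff c s).1 hi).congr fun x => ?_
    rw [norm_mul, Real.norm_of_nonneg (walkPmf_nonneg c s x)]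
  rw [integral_countable h2] at h1
  simp only [measureReal_def, Measure.count_singleton, ENNReal.toReal_one, one_smul] at h1
  rw [← (hasSum_integral_rateOneLaw c s hi).tsum_eq]
  simp only [smul_eq_mul]
  rw [← h1, ← integral_const_mul]
  refine integral_congr_ae (ae_of_all _ fun u => ?_)
  simp only [scaledDensity]
  rcases eq_or_lt_of_le (walkPmf_nonneg c s (scaledSite c s u)) with h0 | hpos
  · rw [← h0]; simp
  · rw [Real.log_mul hs'.ne' hpos.ne', surprisal, ← mul_assoc]
    congr 2; ring

/-- Powers of the logarithm are absorbed by `y ^ (±1/4)`. Both resulting exponents exceed `1/2`, so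
applied to the envelope `(1 + u ^ 2)⁻¹` they remain integrable. -/
lemma mul_abs_log_pow_le {y : ℝ} (hy : 0 ≤ y) (j : ℕ) :
    y * |Real.log y| ^ j ≤ 4 ^ j * j.factorial * (y ^ (5 / 4 : ℝ) + y ^ (3 / 4 : ℝ)) := by
  rcases eq_or_lt_of_le hy with rfl | hy
  · simp only [zero_mul]; positivity
  have h := Real.pow_div_factorial_le_exp (|Real.log y| / 4) (by positivity) j
  rw [div_le_iff₀ (by positivity), div_pow, div_le_iff₀ (by positivity)] at h
  have h2 : Real.exp (|Real.log y| / 4) ≤ y ^ (1 / 4 : ℝ) + y ^ (-(1 / 4) : ℝ) := by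
    rw [Real.rpow_def_of_pos hy, Real.rpow_def_of_pos hy]
    rcases abs_cases (Real.log y) with ⟨h, -⟩ | ⟨h, -⟩ <;> rw [h]
    · refine le_add_of_le_of_nonneg (le_of_eq ?_) (Real.exp_nonneg _)
      congr 1; ring
    · refine le_add_of_nonneg_of_le (Real.exp_nonneg _) (le_of_eq ?_)
      congr 1; ring
  have e1 : y * y ^ (1 / 4 : ℝ) = y ^ (5 / 4 : ℝ) := by
    rw [mul_comm, ← Real.rpow_add_one hy.ne']; norm_num
  have e2 : y * y ^ (-(1 / 4) : ℝ) = y ^ (3 / 4 : ℝ) := by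
    rw [mul_comm, ← Real.rpow_add_one hy.ne']; norm_num
  calc y * |Real.log y| ^ j ≤ y * (Real.exp (|Real.log y| / 4) * j.factorial * 4 ^ j) := by gcongr
    _ ≤ y * ((y ^ (1 / 4 : ℝ) + y ^ (-(1 / 4) : ℝ)) * j.factorial * 4 ^ j) := by gcongr
    _ = 4 ^ j * j.factorial * (y * y ^ (1 / 4 : ℝ) + y * y ^ (-(1 / 4) : ℝ)) := by ring
    _ = _ := by rw [e1, e2]

lemma integrable_inv_one_add_sq_rpow {r : ℝ} (hr : 1 / 2 < r) :
    Integrable fun u : ℝ => ((1 + u ^ 2)⁻¹) ^ r := by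
  have h := integrable_rpow_neg_one_add_norm_sq (E := ℝ) (μ := volume) (r := 2 * r)
    (by simp; linarith)
  refine h.congr (ae_of_all _ fun u => ?_)
  simp only [Real.norm_eq_abs, sq_abs]
  rw [Real.inv_rpow (by positivity), ← Real.rpow_neg (by positivity)]
  congr 1; ring

/-! ### The local central limit theorem -/

lemma tendsto_sqrt_coe_atTop : Tendsto (fun s : ℝ≥0 => √(s : ℝ)) atTop atTop :=
  Real.tendsto_sqrt_atTop.comp (NNReal.tendsto_coe_atTop.2 tendsto_id)

/-- The drift of the steps cancels against the centring of the site, the quadratic term survives,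
and both the cubic remainder and the rounding error (at most one site) are `O(1 / √s)`. -/
lemma tendsto_scaledExponent (c : WalkKind) (u w : ℝ) :
    Tendsto (fun s : ℝ≥0 => (s : ℂ) * (stepChar c (w / √s) - 1)
      - scaledSite c s u * ((w / √s : ℝ) * Complex.I)) atTop
      (𝓝 (-(w : ℂ) ^ 2 / 2 - u * w * Complex.I)) := by
  have hinv : Tendsto (fun s : ℝ≥0 => (√(s : ℝ))⁻¹) atTop (𝓝 0) :=
    tendsto_inv_atTop_zero.comp tendsto_sqrt_coe_atTop
  have hb : Tendsto (fun s : ℝ≥0 => (|w| ^ 3 + |w|) * (√(s : ℝ))⁻¹) atTop (𝓝 0) := by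
    simpa using hinv.const_mul (|w| ^ 3 + |w|)
  have hsmall : ∀ᶠ s : ℝ≥0 in atTop, |w| ≤ √s :=
    tendsto_sqrt_coe_atTop.eventually_ge_atTop _
  rw [tendsto_iff_norm_sub_tendsto_zero]
  refine squeeze_zero' (Eventually.of_forall fun _ => norm_nonneg _) ?_ hb
  filter_upwards [hsmall, eventually_gt_atTop 0] with s hws hs
  have hs' : (0 : ℝ) < √s := Real.sqrt_pos.2 hs
  have hss : (s : ℝ) = √s * √s := (Real.mul_self_sqrt s.2).symm
  set θ := w / √s with hθ
  have hwθ : w = √s * θ := by rw [hθ]; field_simp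
  have hθ1 : |θ| ≤ 1 := by rw [hθ, abs_div, abs_of_pos hs', div_le_one hs']; exact hws
  have h1 := norm_stepChar_sub_le c hθ1
  set x := scaledSite c s u with hx
  have hx1 : (x : ℝ) ≤ walkMean c s + √s * u := Int.floor_le _
  have hx2 : walkMean c s + √s * u < x + 1 := Int.lt_floor_add_one _
  have hδ : |walkMean c s + √s * u - x| ≤ 1 := by rw [abs_le]; constructor <;> linarith
  have e : (s : ℂ) * (stepChar c θ - 1) - x * ((θ : ℝ) * Complex.I)
      - (-(w : ℂ) ^ 2 / 2 - u * w * Complex.I)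
      = s * (stepChar c θ - 1 - drift c * θ * Complex.I + θ ^ 2 / 2)
        + ((walkMean c s + √s * u - x : ℝ) : ℂ) * ((θ : ℝ) * Complex.I) := by
    rw [walkMean_eq]
    have hss' : (s : ℂ) = (√s : ℂ) * (√s : ℂ) := by exact_mod_cast congrArg Complex.ofReal hss
    have hwθ' : (w : ℂ) = (√s : ℂ) * θ := by exact_mod_cast congrArg Complex.ofReal hwθ
    push_cast
    rw [hwθ']
    linear_combination (-(θ : ℂ) ^ 2 / 2) * hss'
  rw [e]
  refine (norm_add_le _ _).trans ?_
  rw [norm_mul, norm_mul, Complex.norm_real, Complex.norm_real, Real.norm_of_nonneg s.coe_nonneg,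
    Real.norm_eq_abs, add_mul]
  have n2 : ‖(θ : ℂ) * Complex.I‖ = |θ| := by simp
  rw [n2]
  refine add_le_add ?_ ?_
  · calc (s : ℝ) * ‖stepChar c θ - 1 - drift c * θ * Complex.I + θ ^ 2 / 2‖
        ≤ s * |θ| ^ 3 := by gcongr
      _ = |w| ^ 3 * (√s)⁻¹ := by
        rw [hθ, abs_div, abs_of_pos hs', hss]; field_simp
        rw [Real.sqrt_sq hs'.le]; ring
  · calc |walkMean c s + √s * u - x| * |θ| ≤ 1 * |θ| := by gcongr
      _ = |w| * (√s)⁻¹ := by rw [hθ, abs_div, abs_of_pos hs']; field_simp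

lemma tendsto_scaledDensity (c : WalkKind) (u : ℝ) :
    Tendsto (fun s => scaledDensity c s u) atTop (𝓝 (gaussianPDFReal 0 1 u)) := by
  have hpi := Real.pi_pos
  have hint : Tendsto (fun s => ∫ w, scaledIntegrand c s (scaledSite c s u) w) atTop
      (𝓝 (∫ w : ℝ, Complex.exp (-(w : ℂ) ^ 2 / 2 - u * w * Complex.I))) := by
    refine tendsto_integral_filter_of_dominated_convergence
      (fun w => Real.exp (-(2 / Real.pi ^ 2) * w ^ 2)) ?_ ?_ integrable_exp_neg_pi_sq ?_
    · refine Eventually.of_forall fun s => ?_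
      refine (Measurable.indicator ?_ measurableSet_Ioc).aestronglyMeasurable
      have := (continuous_stepChar c).measurable
      fun_prop
    · filter_upwards [eventually_gt_atTop 0] with s hs
      exact ae_of_all _ fun w => norm_scaledIntegrand_le c hs _ w
    · refine ae_of_all _ fun w => ?_
      refine ((Complex.continuous_exp.tendsto _).comp (tendsto_scaledExponent c u w)).congr' ?_
      filter_upwards [tendsto_sqrt_coe_atTop.eventually_gt_atTop |w|] with s hs
      have h0 : 0 < √(s : ℝ) := (abs_nonneg w).trans_lt hs
      have h1 := abs_lt.1 hs
      have h2 : √(s : ℝ) ≤ Real.pi * √s := by nlinarith [Real.pi_gt_three]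
      have hmem : w ∈ Set.Ioc (-Real.pi * √s) (Real.pi * √s) := ⟨by linarith, by linarith⟩
      rw [scaledIntegrand, Set.indicator_of_mem hmem]
      rfl
  have hval : (2 * (Real.pi : ℂ))⁻¹ *
      ∫ w : ℝ, Complex.exp (-(w : ℂ) ^ 2 / 2 - u * w * Complex.I)
        = (gaussianPDFReal 0 1 u : ℂ) := by
    have h := fourierIntegral_gaussian (b := 1 / 2) (by norm_num) (-(u : ℂ))
    have e : ∀ w : ℝ, Complex.exp (-(w : ℂ) ^ 2 / 2 - u * w * Complex.I)
        = Complex.exp (Complex.I * -(u : ℂ) * w) * Complex.exp (-(1 / 2) * (w : ℂ) ^ 2) := by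
      intro w; rw [← Complex.exp_add]; congr 1; ring
    simp_rw [e]
    rw [h]
    have e2 : ((Real.pi : ℂ) / (1 / 2)) ^ (1 / 2 : ℂ) = (√(2 * Real.pi) : ℝ) := by
      rw [Real.sqrt_eq_rpow, Complex.ofReal_cpow (by positivity)]
      push_cast; congr 1; ring
    rw [e2]
    have e3 : (2 * Real.pi)⁻¹ * √(2 * Real.pi) = (√(2 * Real.pi))⁻¹ := by
      have : (0 : ℝ) < √(2 * Real.pi) := by positivity
      have h2 := Real.mul_self_sqrt (show (0 : ℝ) ≤ 2 * Real.pi by positivity)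
      rw [← h2, Real.sqrt_mul_self this.le]; field_simp
    have e4 : (2 * (Real.pi : ℂ))⁻¹ * (√(2 * Real.pi) : ℝ) = ((√(2 * Real.pi))⁻¹ : ℝ) := by
      exact_mod_cast congrArg Complex.ofReal e3
    rw [← mul_assoc, e4, gaussianPDFReal]
    push_cast
    simp only [mul_one, sub_zero]
    congr 2; ring
  have h := hint.const_mul ((2 * (Real.pi : ℂ))⁻¹)
  rw [hval] at h
  have h2 := (Complex.continuous_re.tendsto _).comp h
  rw [Complex.ofReal_re] at h2
  refine h2.congr' ?_
  filter_upwards [eventually_gt_atTop 0] with s hs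
  simp only [Function.comp]
  rw [← sqrt_mul_walkPmf_eq c hs, Complex.ofReal_re, scaledDensity]

/-- The limit of the recentred moments of the surprisal. -/
noncomputable def gaussianSurprisalMoment (j : ℕ) : ℝ :=
  ∫ u, (-Real.log (gaussianPDFReal 0 1 u)) ^ j ∂(gaussianReal 0 1)

lemma tendsto_integral_surprisal_sub_pow (c : WalkKind) (j : ℕ) :
    Tendsto (fun s => ∫ x, (surprisal c s x - Real.log √s) ^ j ∂(rateOneLaw c s)) atTop
      (𝓝 (gaussianSurprisalMoment j)) := by
  have hD := pmfConst_pos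
  have e : gaussianSurprisalMoment j
      = ∫ u, gaussianPDFReal 0 1 u * (-Real.log (gaussianPDFReal 0 1 u)) ^ j := by
    rw [gaussianSurprisalMoment, integral_gaussianReal_eq_integral_smul (by simp)]; simp
  rw [e]
  have key : Tendsto (fun s => ∫ u, scaledDensity c s u * (-Real.log (scaledDensity c s u)) ^ j)
      atTop (𝓝 (∫ u, gaussianPDFReal 0 1 u * (-Real.log (gaussianPDFReal 0 1 u)) ^ j)) := by
    refine tendsto_integral_filter_of_dominated_convergence (fun u => 4 ^ j * j.factorial *
      ((15 * pmfConst) ^ (5 / 4 : ℝ) * ((1 + u ^ 2)⁻¹) ^ (5 / 4 : ℝ)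
        + (15 * pmfConst) ^ (3 / 4 : ℝ) * ((1 + u ^ 2)⁻¹) ^ (3 / 4 : ℝ))) ?_ ?_ ?_ ?_
    · refine Eventually.of_forall fun s => ?_
      have := measurable_scaledDensity c s
      exact (this.mul (this.log.neg.pow_const j)).aestronglyMeasurable
    · filter_upwards [eventually_ge_atTop 1] with s hs
      refine ae_of_all _ fun u => ?_
      have h0 := scaledDensity_nonneg c s u
      rw [norm_mul, norm_pow, Real.norm_of_nonneg h0, norm_neg, Real.norm_eq_abs]
      refine (mul_abs_log_pow_le h0 j).trans ?_
      have h1 := scaledDensity_le c hs u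
      rw [← Real.mul_rpow (by positivity) (by positivity),
        ← Real.mul_rpow (by positivity) (by positivity)]
      gcongr
    · exact (((integrable_inv_one_add_sq_rpow (by norm_num)).const_mul _).add
        ((integrable_inv_one_add_sq_rpow (by norm_num)).const_mul _)).const_mul _
    · refine ae_of_all _ fun u => ?_
      have h := tendsto_scaledDensity c u
      exact h.mul ((h.log (gaussianPDFReal_pos 0 1 u (by simp)).ne').neg.pow j)
  refine key.congr' ?_
  filter_upwards [eventually_gt_atTop 0] with s hs
  exact (integral_surprisal_sub_pow c hs j).symm

/-! ### Variance of the surprisal -/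

/-- The variance of the surprisal (the varentropy) of the rate-1 walk at time `s`. -/
noncomputable def walkVarentropy (c : WalkKind) (s : ℝ≥0) : ℝ :=
  Var[surprisal c s; rateOneLaw c s]

lemma memLp_surprisal_sub (c : WalkKind) (s : ℝ≥0) (l : ℝ) :
    MemLp (fun x => surprisal c s x - l) 2 (rateOneLaw c s) := by
  rw [memLp_two_iff_integrable_sq .of_discrete]
  exact integrable_surprisal_sub_pow c s l 2

lemma memLp_surprisal (c : WalkKind) (s : ℝ≥0) :
    MemLp (surprisal c s) 2 (rateOneLaw c s) := by
  simpa using memLp_surprisal_sub c s 0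

lemma walkVarentropy_eq (c : WalkKind) (s : ℝ≥0) :
    walkVarentropy c s = surprisalMoment c 2 s - walkEntropy c s ^ 2 := by
  rw [walkVarentropy, variance_eq_sub (memLp_surprisal c s)]; rfl

/-- Variance ignores the constant `l`; taking `l = log √s` replaces moments that diverge as `s → ∞`
by convergent ones. -/
lemma walkVarentropy_eq_sub (c : WalkKind) (s : ℝ≥0) (l : ℝ) :
    walkVarentropy c s = ∫ x, (surprisal c s x - l) ^ 2 ∂(rateOneLaw c s)
      - (∫ x, (surprisal c s x - l) ^ 1 ∂(rateOneLaw c s)) ^ 2 := by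
  have h := variance_eq_sub (memLp_surprisal_sub c s l)
  rw [variance_sub_const .of_discrete] at h
  simpa [walkVarentropy] using h

/-- The large-time limit of the varentropy. -/
noncomputable def gaussianVarentropy : ℝ :=
  gaussianSurprisalMoment 2 - gaussianSurprisalMoment 1 ^ 2

lemma tendsto_walkVarentropy_atTop (c : WalkKind) :
    Tendsto (walkVarentropy c) atTop (𝓝 gaussianVarentropy) :=
  ((tendsto_integral_surprisal_sub_pow c 2).sub
    ((tendsto_integral_surprisal_sub_pow c 1).pow 2)).congr
    fun s => (walkVarentropy_eq_sub c s _).symm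

lemma neg_log_gaussianPDFReal (u : ℝ) :
    -Real.log (gaussianPDFReal 0 1 u) = Real.log (√(2 * Real.pi)) + u ^ 2 / 2 := by
  have hpi := Real.pi_pos
  simp only [gaussianPDFReal, NNReal.coe_one, mul_one, sub_zero]
  rw [Real.log_mul (by positivity) (Real.exp_pos _).ne', Real.log_exp, Real.log_inv]
  ring

/-- The Gaussian surprisal is a constant plus `u² / 2`; zero variance would make it constant, but
its values at `0` and `1` differ. -/
lemma gaussianVarentropy_pos : 0 < gaussianVarentropy := by
  have hm : MemLp (fun u => -Real.log (gaussianPDFReal 0 1 u)) 2 (gaussianReal 0 1) := by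
    simp_rw [neg_log_gaussianPDFReal]
    have h := (memLp_id_gaussianReal (μ := 0) (v := 1) 4)
    have h2 : MemLp (fun u : ℝ => u ^ 2) 2 (gaussianReal 0 1) := by
      rw [memLp_two_iff_integrable_sq (by fun_prop)]
      have h3 := h.integrable_norm_pow (by norm_num)
      refine h3.congr (ae_of_all _ fun u => ?_)
      simp only [id, Real.norm_eq_abs]
      rw [← pow_mul]
      exact Even.pow_abs (by decide) u
    exact (memLp_const (Real.log √(2 * Real.pi))).add (by simpa [div_eq_mul_inv] using h2.mul_const (2⁻¹ : ℝ))
  have hv := variance_eq_sub hm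
  have e : Var[fun u => -Real.log (gaussianPDFReal 0 1 u); gaussianReal 0 1]
      = gaussianVarentropy := by
    rw [hv]; simp [gaussianVarentropy, gaussianSurprisalMoment]
  rw [← e]
  refine lt_of_le_of_ne (variance_nonneg _ _) fun h0 => ?_
  have hae := ae_eq_integral_of_variance_eq_zero hm h0.symm
  have hae2 := (gaussianReal_absolutelyContinuous' 0 (v := 1) (by simp)).ae_le hae
  simp_rw [neg_log_gaussianPDFReal] at hae2
  have h1 := (Continuous.ae_eq_iff_eq volume (by fun_prop) (by fun_prop)).1 hae2
  have h2 := congrFun h1 0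
  have h3 := congrFun h1 1
  rw [← h2] at h3
  norm_num at h3

/-- Zero variance would make the mass function constant on the natural numbers, hence not summable.
-/
lemma walkVarentropy_pos (c : WalkKind) {s : ℝ≥0} (hs : 0 < s) : 0 < walkVarentropy c s := by
  refine lt_of_le_of_ne (variance_nonneg _ _) fun h0 => ?_
  have hae := ae_eq_integral_of_variance_eq_zero (memLp_surprisal c s) h0.symm
  have hpt : ∀ x, reachable c x →
      surprisal c s x = ∫ y, surprisal c s y ∂(rateOneLaw c s) := by
    intro x hx
    have hpos := walkPmf_pos c hs hx
    by_contra hne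
    have h1 : rateOneLaw c s {x} ≤ 0 := by
      rw [← ae_iff.1 hae]
      exact measure_mono (by simpa using hne)
    rw [walkPmf, measureReal_def, nonpos_iff_eq_zero.1 h1] at hpos
    simp at hpos
  have hnat : ∀ m : ℕ, walkPmf c s (m : ℤ) = walkPmf c s 0 := by
    intro m
    have hm : reachable c (m : ℤ) := by cases c <;> simp [reachable]
    have h1 := (hpt _ hm).trans (hpt _ (reachable_zero c)).symm
    exact Real.log_injOn_pos (walkPmf_pos c hs hm) (walkPmf_pos c hs (reachable_zero c))
      (neg_injective h1)
  have hsum : Summable fun m : ℕ => walkPmf c s (m : ℤ) :=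
    (hasSum_walkPmf c s).summable.comp_injective Nat.cast_injective
  simp_rw [hnat] at hsum
  exact (walkPmf_pos c hs (reachable_zero c)).ne' ((summable_const_iff _).1 hsum)

lemma continuousAt_walkVarentropy (c : WalkKind) {s : ℝ≥0} (hs : 0 < s) :
    ContinuousAt (walkVarentropy c) s := by
  rw [show walkVarentropy c = fun s => surprisalMoment c 2 s - walkEntropy c s ^ 2 from
    funext (walkVarentropy_eq c)]
  exact (continuousAt_surprisalMoment c 2 hs).sub ((continuous_walkEntropy c).continuousAt.pow 2)

/-- The fourth central moment of the surprisal of the rate-1 walk at time `s`. -/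
noncomputable def surprisalFourth (c : WalkKind) (s : ℝ≥0) : ℝ :=
  ∫ x, (surprisal c s x - walkEntropy c s) ^ 4 ∂(rateOneLaw c s)

lemma surprisalFourth_nonneg (c : WalkKind) (s : ℝ≥0) : 0 ≤ surprisalFourth c s :=
  integral_nonneg fun _ => by positivity

lemma surprisalFourth_le (c : WalkKind) (s : ℝ≥0) (l : ℝ) :
    surprisalFourth c s ≤ 8 * (∫ x, (surprisal c s x - l) ^ 4 ∂(rateOneLaw c s)
      + (∫ x, (surprisal c s x - l) ^ 1 ∂(rateOneLaw c s)) ^ 4) := by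
  have hl : ∫ x, (surprisal c s x - l) ^ 1 ∂(rateOneLaw c s) = walkEntropy c s - l := by
    have h1 := integrable_surprisal_pow c s 1
    simp only [pow_one] at h1 ⊢
    rw [integral_sub h1 (integrable_const _)]
    simp [walkEntropy]
  rw [hl]
  set h := walkEntropy c s
  have hi := ((integrable_surprisal_sub_pow c s l 4).add (integrable_const ((h - l) ^ 4))).const_mul 8
  calc surprisalFourth c s
      ≤ ∫ x, 8 * ((surprisal c s x - l) ^ 4 + (h - l) ^ 4) ∂(rateOneLaw c s) := by
        refine integral_mono (integrable_surprisal_sub_pow c s h 4) hi fun x => ?_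
        have e : surprisal c s x - h = (surprisal c s x - l) - (h - l) := by ring
        change (surprisal c s x - h) ^ 4 ≤ 8 * ((surprisal c s x - l) ^ 4 + (h - l) ^ 4)
        rw [e]
        generalize surprisal c s x - l = a
        generalize h - l = b
        have h1 : (a - b) ^ 2 ≤ 2 * (a ^ 2 + b ^ 2) := by nlinarith [sq_nonneg (a + b)]
        calc (a - b) ^ 4 = ((a - b) ^ 2) ^ 2 := by ring
          _ ≤ (2 * (a ^ 2 + b ^ 2)) ^ 2 := pow_le_pow_left₀ (sq_nonneg _) h1 2
          _ ≤ 8 * (a ^ 4 + b ^ 4) := by nlinarith [sq_nonneg (a ^ 2 - b ^ 2)]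
    _ = _ := by
        rw [integral_const_mul, integral_add (integrable_surprisal_sub_pow c s l 4)
          (integrable_const _)]
        simp

lemma surprisalFourth_le_moment (c : WalkKind) (s : ℝ≥0) :
    surprisalFourth c s ≤ 8 * (surprisalMoment c 4 s + walkEntropy c s ^ 4) := by
  simpa [surprisalMoment, walkEntropy] using surprisalFourth_le c s 0

/-- The normalized fourth central moment (kurtosis) of the surprisal. -/
noncomputable def surprisalKurtosis (c : WalkKind) (s : ℝ≥0) : ℝ :=
  surprisalFourth c s / walkVarentropy c s ^ 2

lemma surprisalKurtosis_nonneg (c : WalkKind) (s : ℝ≥0) : 0 ≤ surprisalKurtosis c s :=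
  div_nonneg (surprisalFourth_nonneg c s) (sq_nonneg _)

lemma eventually_surprisalKurtosis_le_atTop (c : WalkKind) :
    ∃ C, ∀ᶠ s in atTop, surprisalKurtosis c s ≤ C := by
  have h := (((tendsto_integral_surprisal_sub_pow c 4).add
    ((tendsto_integral_surprisal_sub_pow c 1).pow 4)).const_mul 8).div
      ((tendsto_walkVarentropy_atTop c).pow 2) (pow_pos gaussianVarentropy_pos 2).ne'
  refine ⟨_, (h.eventually_le_const (lt_add_one _)).mono fun s hs => le_trans ?_ hs⟩
  exact div_le_div_of_nonneg_right (surprisalFourth_le c s _) (sq_nonneg _)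

lemma eventually_surprisalKurtosis_le_nhds (c : WalkKind) {a : ℝ≥0} (ha : 0 < a) :
    ∃ C, ∀ᶠ s in 𝓝 a, surprisalKurtosis c s ≤ C := by
  have h := (((continuousAt_surprisalMoment c 4 ha).tendsto.add
    (((continuous_walkEntropy c).tendsto a).pow 4)).const_mul 8).div
      ((continuousAt_walkVarentropy c ha).tendsto.pow 2) (pow_pos (walkVarentropy_pos c ha) 2).ne'
  refine ⟨_, (h.eventually_le_const (lt_add_one _)).mono fun s hs => le_trans ?_ hs⟩
  exact div_le_div_of_nonneg_right (surprisalFourth_le_moment c s) (sq_nonneg _)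

/-! ### Small-time asymptotics -/

lemma eventually_neg_log_pos : ∀ᶠ s : ℝ≥0 in 𝓝[>] 0, 0 < (s : ℝ) ∧ 0 < -Real.log s := by
  filter_upwards [eventually_small_time] with s hs
  have hs' : (0 : ℝ) < s := hs.1
  exact ⟨hs', by linarith [Real.log_neg hs' (by exact_mod_cast hs.2)]⟩

lemma tendsto_walkEntropy_div (c : WalkKind) :
    Tendsto (fun s : ℝ≥0 => walkEntropy c s / (s * -Real.log s)) (𝓝[>] 0) (𝓝 1) := by
  simpa [walkEntropy_eq] using tendsto_surprisalMoment_div c le_rfl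

lemma tendsto_walkVarentropy_div (c : WalkKind) :
    Tendsto (fun s : ℝ≥0 => walkVarentropy c s / (s * (-Real.log s) ^ 2)) (𝓝[>] 0) (𝓝 1) := by
  have h := (tendsto_surprisalMoment_div c (j := 2) (by norm_num)).sub
    (((tendsto_walkEntropy_div c).pow 2).mul tendsto_coe_nhdsGT_zero)
  simp only [one_pow, mul_zero, sub_zero] at h
  refine h.congr' ?_
  filter_upwards [eventually_neg_log_pos] with s ⟨hs, hL⟩
  rw [walkVarentropy_eq]
  generalize -Real.log s = L at *
  field_simp

lemma tendsto_neg_log_walkEntropy_div (c : WalkKind) :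
    Tendsto (fun s : ℝ≥0 => -Real.log (walkEntropy c s) / -Real.log s) (𝓝[>] 0) (𝓝 1) := by
  have h1 := (tendsto_walkEntropy_div c).log one_ne_zero
  rw [Real.log_one] at h1
  have hL := tendsto_neg_log_nhdsGT
  have h2 : Tendsto (fun s : ℝ≥0 => Real.log (-Real.log s) / (-Real.log s)) (𝓝[>] 0) (𝓝 0) := by
    have := Real.isLittleO_log_id_atTop.tendsto_div_nhds_zero
    exact this.comp hL
  -- To first order `h` is `s log (1/s)`, so `log h` differs from `log s` by `log log (1/s) + o(1)`.
  have h3 := ((h1.mul (tendsto_inv_atTop_zero.comp hL)).add h2).const_sub 1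
  simp only [mul_zero, add_zero, sub_zero] at h3
  refine h3.congr' ?_
  filter_upwards [eventually_neg_log_pos] with s ⟨hs, hL⟩
  have hh : 0 < walkEntropy c s := by
    have := walkEntropy_strictMono c (show (0 : ℝ≥0) < s from hs)
    rwa [walkEntropy_zero] at this
  rw [Real.log_div hh.ne' (by positivity), Real.log_mul hs.ne' hL.ne']
  have hne : Real.log s ≠ 0 := by linarith
  simp only [Function.comp]
  field_simp
  ring

lemma walkEntropy_pos (c : WalkKind) {s : ℝ≥0} (hs : 0 < s) : 0 < walkEntropy c s := by
  have := walkEntropy_strictMono c hs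
  rwa [walkEntropy_zero] at this

lemma tendsto_walkEntropy_nhdsGT (c : WalkKind) :
    Tendsto (walkEntropy c) (𝓝[>] 0) (𝓝[>] 0) := by
  refine tendsto_nhdsWithin_iff.2 ⟨?_, ?_⟩
  · have := (continuous_walkEntropy c).tendsto 0
    rw [walkEntropy_zero] at this
    exact this.mono_left nhdsWithin_le_nhds
  · filter_upwards [self_mem_nhdsWithin] with s hs
    exact walkEntropy_pos c hs

lemma tendsto_neg_log_walkEntropy (c : WalkKind) :
    Tendsto (fun s => -Real.log (walkEntropy c s)) (𝓝[>] 0) atTop :=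
  tendsto_neg_atBot_atTop.comp (Real.tendsto_log_nhdsGT_zero.comp (tendsto_walkEntropy_nhdsGT c))

/-- For small times, the varentropy is asymptotic to `h log (1 / h)`, where `h` is the entropy. -/
lemma tendsto_walkVarentropy_div_entropy (c : WalkKind) :
    Tendsto (fun s => walkVarentropy c s / (walkEntropy c s * -Real.log (walkEntropy c s)))
      (𝓝[>] 0) (𝓝 1) := by
  have h := (tendsto_walkVarentropy_div c).div ((tendsto_walkEntropy_div c).mul
    (tendsto_neg_log_walkEntropy_div c)) (by norm_num)
  simp only [mul_one, div_one] at h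
  refine h.congr' ?_
  filter_upwards [eventually_neg_log_pos,
    (tendsto_neg_log_walkEntropy c).eventually_gt_atTop 0] with s ⟨hs, hL⟩ hlh
  have hh := walkEntropy_pos c (show (0 : ℝ≥0) < s from hs)
  simp only [Pi.div_apply]
  generalize -Real.log (walkEntropy c s) = M at *
  generalize -Real.log s = L at *
  field_simp

lemma eventually_surprisalKurtosis_mul_le (c : WalkKind) :
    ∀ᶠ s in 𝓝[>] 0, surprisalKurtosis c s * walkEntropy c s ≤
      9 * -Real.log (walkEntropy c s) := by
  have h4 := ((tendsto_surprisalMoment_div c (j := 4) (by norm_num)).add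
    (((tendsto_walkEntropy_div c).pow 4).mul (tendsto_coe_nhdsGT_zero.pow 3))).const_mul 8
  have h := ((h4.div ((tendsto_walkVarentropy_div c).pow 2) (by norm_num)).mul
    (tendsto_walkEntropy_div c)).div (tendsto_neg_log_walkEntropy_div c) one_ne_zero
  -- The limit is `8`, the constant of `surprisalFourth_le`; any larger number would serve.
  have h9 := h.eventually_le_const (u := 9) (by norm_num)
  filter_upwards [h9, eventually_neg_log_pos,
    (tendsto_neg_log_walkEntropy c).eventually_gt_atTop 0] with s hs9 ⟨hs, hL⟩ hlh
  have hh := walkEntropy_pos c (show (0 : ℝ≥0) < s from hs)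
  have hv := walkVarentropy_pos c (show (0 : ℝ≥0) < s from hs)
  rw [← div_le_iff₀ hlh]
  refine le_trans ?_ hs9
  simp only [Pi.div_apply]
  have hU := surprisalFourth_le_moment c s
  generalize -Real.log (walkEntropy c s) = M at *
  generalize -Real.log s = L at *
  unfold surprisalKurtosis
  calc surprisalFourth c s / walkVarentropy c s ^ 2 * walkEntropy c s / M
      ≤ (8 * (surprisalMoment c 4 s + walkEntropy c s ^ 4)) / walkVarentropy c s ^ 2
          * walkEntropy c s / M := by gcongr
    _ = _ := by field_simp

/-! ### The asymptotic regime along ultrafilters. -/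

/-- This plays the role of extracting subsequences: no assumption is made on how `log n` compares
with `k`, so `s` itself need not converge. -/
lemma ultrafilter_nnreal_trichotomy {ι : Type*} (F : Ultrafilter ι) {s : ι → ℝ≥0}
    (hs : ∀ᶠ i in F, 0 < s i) :
    Tendsto s F (𝓝[>] 0) ∨ (∃ a > 0, Tendsto s F (𝓝 a)) ∨ Tendsto s F atTop := by
  by_cases hB : ∃ b, ∀ᶠ i in F, s i ≤ b
  · obtain ⟨b, hb⟩ := hB
    obtain ⟨a, -, ha⟩ := (isCompact_Icc (a := (0 : ℝ≥0)) (b := b)).ultrafilter_le_nhds (F.map s)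
      (by
        rw [le_principal_iff]
        exact hb.mono fun i hi => ⟨zero_le, hi⟩)
    have ha' : Tendsto s F (𝓝 a) := ha
    rcases eq_or_lt_of_le (zero_le : 0 ≤ a) with rfl | hpos
    · exact Or.inl (tendsto_nhdsWithin_iff.2 ⟨ha', hs⟩)
    · exact Or.inr (Or.inl ⟨a, hpos, ha'⟩)
  · push Not at hB
    refine Or.inr (Or.inr (tendsto_atTop.2 fun b => ?_))
    exact (hB b).mono fun i hi => hi.le

/-- The asymptotic regime: `k` generators, log-size `l` of the group, and a time `s`
at which the entropy of a coordinate is `l / k`. -/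
structure EntropicRegime (c : WalkKind) (F : Filter ℕ) (k : ℕ → ℕ) (l : ℕ → ℝ) (s : ℕ → ℝ≥0) :
    Prop where
  tendsto_k : Tendsto (fun N => (k N : ℝ)) F atTop
  tendsto_l : Tendsto l F atTop
  log_div : Tendsto (fun N => Real.log (k N) / l N) F (𝓝 0)
  entropy : ∀ᶠ N in F, walkEntropy c (s N) = l N / k N

namespace EntropicRegime

variable {c : WalkKind} {F : Filter ℕ} {k : ℕ → ℕ} {l : ℕ → ℝ} {s s' : ℕ → ℝ≥0}

lemma mono (h : EntropicRegime c F k l s) {G : Filter ℕ} (hG : G ≤ F) :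
    EntropicRegime c G k l s :=
  ⟨h.1.mono_left hG, h.2.mono_left hG, h.3.mono_left hG, h.4.filter_mono hG⟩

lemma eventually_pos (h : EntropicRegime c F k l s) :
    ∀ᶠ N in F, 0 < s N ∧ 0 < (k N : ℝ) ∧ 0 < l N ∧ l N = k N * walkEntropy c (s N) := by
  filter_upwards [h.tendsto_k.eventually_gt_atTop 0, h.tendsto_l.eventually_gt_atTop 0,
    h.entropy] with N hk hl he
  have h1 : 0 < walkEntropy c (s N) := by rw [he]; positivity
  refine ⟨?_, hk, hl, ?_⟩
  · by_contra h0
    rw [nonpos_iff_eq_zero.1 (not_lt.1 h0), walkEntropy_zero] at h1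
    exact lt_irrefl _ h1
  · rw [he]; field_simp

/-- What the central limit theorem needs of the varentropy and the kurtosis. -/
structure Conclusion (c : WalkKind) (F : Filter ℕ) (k : ℕ → ℕ) (l : ℕ → ℝ) (s s' : ℕ → ℝ≥0) :
    Prop where
  window : Tendsto (fun N => walkVarentropy c (s N) * k N / l N ^ 2) F (𝓝 0)
  variance : Tendsto (fun N => walkVarentropy c (s N) * k N) F atTop
  ratio : Tendsto (fun N => walkVarentropy c (s' N) / walkVarentropy c (s N)) F (𝓝 1)
  lyapunov : Tendsto (fun N => surprisalKurtosis c (s' N) / k N) F (𝓝 0)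

/-- Covers both a positive limit of `s` and `s → ∞`. Since `l = k h`, the window is `v / (l h)`, and
`h` is bounded below. -/
lemma conclusion_of_tendsto_pos (h : EntropicRegime c F k l s) {v δ C : ℝ} (hv : 0 < v)
    (h1 : Tendsto (fun N => walkVarentropy c (s N)) F (𝓝 v))
    (h2 : Tendsto (fun N => walkVarentropy c (s' N)) F (𝓝 v))
    (hδ : 0 < δ) (h3 : ∀ᶠ N in F, δ ≤ walkEntropy c (s N))
    (h4 : ∀ᶠ N in F, surprisalKurtosis c (s' N) ≤ C) : Conclusion c F k l s s' where
  window := by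
    have hb : Tendsto (fun N => walkVarentropy c (s N) * ((l N)⁻¹ * δ⁻¹)) F (𝓝 0) := by
      simpa using h1.mul ((tendsto_inv_atTop_zero.comp h.tendsto_l).mul_const δ⁻¹)
    refine squeeze_zero' ?_ ?_ hb
    · exact Eventually.of_forall fun N => div_nonneg
        (mul_nonneg (variance_nonneg _ _) (Nat.cast_nonneg _)) (sq_nonneg _)
    · filter_upwards [h.eventually_pos, h3] with N ⟨hs, hk, hl, he⟩ hd
      have hvn : 0 ≤ walkVarentropy c (s N) := variance_nonneg _ _
      rw [mul_div_assoc]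
      refine mul_le_mul_of_nonneg_left ?_ hvn
      have hh := walkEntropy_pos c hs
      have e : (k N : ℝ) / l N ^ 2 = (l N)⁻¹ * (walkEntropy c (s N))⁻¹ := by
        rw [pow_two]; nth_rewrite 1 [he]; field_simp
      rw [e]
      gcongr
  variance := h1.pos_mul_atTop hv h.tendsto_k
  ratio := by simpa [hv.ne', Pi.div_def] using h2.div h1 hv.ne'
  lyapunov := by
    have hb : Tendsto (fun N => C * (k N : ℝ)⁻¹) F (𝓝 0) := by
      simpa using (tendsto_inv_atTop_zero.comp h.tendsto_k).const_mul C
    refine squeeze_zero' ?_ ?_ hb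
    · exact Eventually.of_forall fun N =>
        div_nonneg (surprisalKurtosis_nonneg _ _) (Nat.cast_nonneg _)
    · filter_upwards [h4] with N hN
      rw [div_eq_mul_inv]
      gcongr

/-- With `L = log (1/h)` and `l = k h`, the relation `v ~ h L` turns `vk / l²` into `L / l` and `vk`
into `l L`, while the kurtosis over `k` is `O(L / l)`. -/
lemma conclusion_of_tendsto_zero (h : EntropicRegime c F k l s)
    (hs : Tendsto s F (𝓝[>] 0)) (hs' : Tendsto s' F (𝓝[>] 0))
    (hr : Tendsto (fun N => walkEntropy c (s' N) / walkEntropy c (s N)) F (𝓝 1)) :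
    Conclusion c F k l s s' := by
  have hL := (tendsto_neg_log_walkEntropy c).comp hs
  have hV := (tendsto_walkVarentropy_div_entropy c).comp hs
  have hV' := (tendsto_walkVarentropy_div_entropy c).comp hs'
  -- Here `log k = o(l)` enters: `L = log k - log l ≤ log k` as soon as `l ≥ 1`.
  have hLk : Tendsto (fun N => -Real.log (walkEntropy c (s N)) / l N) F (𝓝 0) := by
    refine squeeze_zero' ?_ ?_ h.log_div
    · filter_upwards [hL.eventually_gt_atTop 0, h.eventually_pos] with N h1 h2
      exact div_nonneg h1.le h2.2.2.1.le
    · filter_upwards [h.tendsto_l.eventually_ge_atTop 1, h.eventually_pos, h.entropy]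
        with N h1 ⟨_, hk, hl, _⟩ he
      rw [he, Real.log_div hl.ne' hk.ne']
      have := Real.log_nonneg h1
      gcongr
      linarith
  have hLr : Tendsto (fun N => -Real.log (walkEntropy c (s' N)) / -Real.log (walkEntropy c (s N)))
      F (𝓝 1) := by
    have h1 := hr.log one_ne_zero
    rw [Real.log_one] at h1
    have h2 := (h1.mul (tendsto_inv_atTop_zero.comp hL)).const_sub 1
    simp only [mul_zero, sub_zero] at h2
    refine h2.congr' ?_
    filter_upwards [hL.eventually_gt_atTop 0, hs.eventually self_mem_nhdsWithin,
      hs'.eventually self_mem_nhdsWithin] with N h0 hN hN'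
    simp only [Function.comp] at h0 ⊢
    rw [Real.log_div (walkEntropy_pos c hN').ne' (walkEntropy_pos c hN).ne']
    have hne : Real.log (walkEntropy c (s N)) ≠ 0 := by linarith
    field_simp
    ring
  have hpos : ∀ᶠ N in F, 0 < walkEntropy c (s N) ∧ 0 < -Real.log (walkEntropy c (s N)) ∧
      0 < walkEntropy c (s' N) ∧ 0 < -Real.log (walkEntropy c (s' N)) := by
    filter_upwards [hL.eventually_gt_atTop 0, hs.eventually self_mem_nhdsWithin,
      hs'.eventually self_mem_nhdsWithin,
      ((tendsto_neg_log_walkEntropy c).comp hs').eventually_gt_atTop 0] with N h0 hN hN' h0'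
    exact ⟨walkEntropy_pos c hN, h0, walkEntropy_pos c hN', h0'⟩
  refine ⟨?_, ?_, ?_, ?_⟩
  · have h1 := hV.mul hLk
    rw [one_mul] at h1
    refine h1.congr' ?_
    filter_upwards [hpos, h.eventually_pos] with N ⟨hh, hl, _, _⟩ ⟨_, hk, _, he⟩
    simp only [Function.comp]
    rw [he]
    generalize -Real.log (walkEntropy c (s N)) = M at *
    field_simp
  · have h1 := hV.pos_mul_atTop one_pos (h.tendsto_l.atTop_mul_atTop₀ hL)
    refine h1.congr' ?_
    filter_upwards [hpos, h.eventually_pos] with N ⟨hh, hl, _, _⟩ ⟨_, hk, _, he⟩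
    simp only [Function.comp]
    rw [he]
    generalize -Real.log (walkEntropy c (s N)) = M at *
    field_simp
  · have h1 := (hV'.mul (hr.mul hLr)).div hV one_ne_zero
    simp only [mul_one, div_one] at h1
    refine h1.congr' ?_
    filter_upwards [hpos, h.eventually_pos] with N ⟨hh, hl, hh', hl'⟩ ⟨hs0, hk, _, he⟩
    have := walkVarentropy_pos c hs0
    simp only [Function.comp, Pi.div_apply]
    generalize -Real.log (walkEntropy c (s N)) = M at *
    generalize -Real.log (walkEntropy c (s' N)) = M' at *
    field_simp
  · have hb := ((hLr.div hr one_ne_zero).mul hLk).const_mul 9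
    simp only [mul_zero] at hb
    refine squeeze_zero' ?_ ?_ hb
    · exact Eventually.of_forall fun N =>
        div_nonneg (surprisalKurtosis_nonneg _ _) (Nat.cast_nonneg _)
    · filter_upwards [hpos, h.eventually_pos,
        hs'.eventually (eventually_surprisalKurtosis_mul_le c)]
        with N ⟨hh, hl, hh', hl'⟩ ⟨_, hk, _, he⟩ hK
      rw [← le_div_iff₀ hh'] at hK
      simp only [Pi.div_apply]
      rw [he]
      generalize -Real.log (walkEntropy c (s N)) = M at *
      generalize -Real.log (walkEntropy c (s' N)) = M' at *
      calc surprisalKurtosis c (s' N) / k N ≤ (9 * M' / walkEntropy c (s' N)) / k N := by gcongr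
        _ = _ := by field_simp

lemma tendsto_of_entropy_ratio {G : Filter ℕ} {a : ℝ≥0} (ha : Tendsto s G (𝓝 a))
    (hpos : ∀ᶠ N in G, 0 < s N)
    (hr : Tendsto (fun N => walkEntropy c (s' N) / walkEntropy c (s N)) G (𝓝 1)) :
    Tendsto s' G (𝓝 a) := by
  have h1 : Tendsto (fun N => walkEntropy c (s' N)) G (𝓝 (walkEntropy c a)) := by
    have h2 := hr.mul (((continuous_walkEntropy c).tendsto a).comp ha)
    rw [one_mul] at h2
    refine h2.congr' ?_
    filter_upwards [hpos] with N hN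
    have := walkEntropy_pos c hN
    simp only [Function.comp]
    field_simp
  have h3 : Tendsto (fun N => entropyHomeo c (s' N)) G (𝓝 (entropyHomeo c a)) :=
    NNReal.tendsto_coe.1 h1
  have h4 := ((entropyHomeo c).symm.continuous.tendsto _).comp h3
  simpa [Function.comp_def] using h4

lemma tendsto_atTop_of_entropy (h1 : Tendsto (fun N => walkEntropy c (s' N)) F atTop) :
    Tendsto s' F atTop := by
  refine tendsto_atTop.2 fun b => ?_
  filter_upwards [h1.eventually_ge_atTop (walkEntropy c b)] with N hN
  exact (walkEntropy_strictMono c).le_iff_le.1 hN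

/-- A limit may be tested on the ultrafilters below `F`. On each of them the entropy ratio forces
`s'` to have the same limit as `s`. -/
lemma conclusion (h : EntropicRegime c F k l s)
    (hr : Tendsto (fun N => walkEntropy c (s' N) / walkEntropy c (s N)) F (𝓝 1)) :
    Conclusion c F k l s s' := by
  have key : ∀ G : Ultrafilter ℕ, ↑G ≤ F → Conclusion c G k l s s' := by
    intro G hG
    have hG' := h.mono hG
    have hrG := hr.mono_left hG
    have hpos : ∀ᶠ N in G, 0 < s N := hG'.eventually_pos.mono fun N hN => hN.1
    rcases ultrafilter_nnreal_trichotomy G hpos with h0 | ⟨a, ha, hsa⟩ | htop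
    · refine hG'.conclusion_of_tendsto_zero h0 (tendsto_nhdsWithin_iff.2 ⟨?_, ?_⟩) hrG
      · exact tendsto_of_entropy_ratio (tendsto_nhdsWithin_iff.1 h0).1 hpos hrG
      · filter_upwards [hrG.eventually (lt_mem_nhds one_pos), hpos] with N hN hsN
        have h1 := (div_pos_iff_of_pos_right (walkEntropy_pos c hsN)).1 hN
        by_contra hc
        rw [Set.mem_Ioi] at hc
        rw [nonpos_iff_eq_zero.1 (not_lt.1 hc), walkEntropy_zero] at h1
        exact lt_irrefl _ h1
    · have hs'a := tendsto_of_entropy_ratio hsa hpos hrG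
      have hv := (continuousAt_walkVarentropy c ha).tendsto
      obtain ⟨C, hC⟩ := eventually_surprisalKurtosis_le_nhds c ha
      have hh := walkEntropy_pos c ha
      refine hG'.conclusion_of_tendsto_pos (walkVarentropy_pos c ha) (hv.comp hsa) (hv.comp hs'a)
        (half_pos hh) ?_ (hs'a.eventually hC)
      exact (((continuous_walkEntropy c).tendsto a).comp hsa).eventually_const_le (half_lt_self hh)
    · have hh := (tendsto_walkEntropy_atTop c).comp htop
      have hs'top : Tendsto s' G atTop := by
        refine tendsto_atTop_of_entropy (c := c) ?_
        refine (hrG.pos_mul_atTop one_pos hh).congr' ?_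
        filter_upwards [hpos] with N hN
        have := walkEntropy_pos c hN
        simp only [Function.comp]
        field_simp
      have hv := tendsto_walkVarentropy_atTop c
      obtain ⟨C, hC⟩ := eventually_surprisalKurtosis_le_atTop c
      exact hG'.conclusion_of_tendsto_pos gaussianVarentropy_pos (hv.comp htop) (hv.comp hs'top)
        one_pos (hh.eventually_ge_atTop 1) (hs'top.eventually hC)
  exact ⟨tendsto_iff_ultrafilter _ _ _ |>.2 fun G hG => (key G hG).window,
    tendsto_iff_ultrafilter _ _ _ |>.2 fun G hG => (key G hG).variance,
    tendsto_iff_ultrafilter _ _ _ |>.2 fun G hG => (key G hG).ratio,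
    tendsto_iff_ultrafilter _ _ _ |>.2 fun G hG => (key G hG).lyapunov⟩

end EntropicRegime

/-! ### A quantitative central limit theorem for characteristic functions -/

/-- For `|x| ≤ 1` this is Taylor's formula; for `|x| ≥ 1` the four terms are bounded one by one,
with total at most `7/2 |x| ^ 3`. -/
lemma norm_cexp_mul_I_sub_le (x : ℝ) :
    ‖Complex.exp (x * Complex.I) - 1 - x * Complex.I + x ^ 2 / 2‖ ≤ 4 * |x| ^ 3 := by
  rcases le_total |x| 1 with hx | hx
  · have h := norm_stepChar_sub_le .directed hx
    simp only [stepChar, drift, Complex.ofReal_one, one_mul] at h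
    have : 0 ≤ |x| ^ 3 := by positivity
    linarith
  · have h1 : ‖Complex.exp (x * Complex.I)‖ = 1 := Complex.norm_exp_ofReal_mul_I x
    have h2 : ‖(x : ℂ) * Complex.I‖ = |x| := by simp
    have h3 : ‖(x : ℂ) ^ 2 / 2‖ = |x| ^ 2 / 2 := by simp
    have h4 : |x| ≤ |x| ^ 3 := le_self_pow₀ hx (by norm_num)
    have h5 : |x| ^ 2 ≤ |x| ^ 3 := pow_le_pow_right₀ hx (by norm_num)
    calc _ ≤ ‖Complex.exp (x * Complex.I)‖ + ‖(1 : ℂ)‖ + ‖(x : ℂ) * Complex.I‖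
          + ‖(x : ℂ) ^ 2 / 2‖ := by
          refine (norm_add_le _ _).trans (add_le_add_left ?_ _)
          refine (norm_sub_le _ _).trans (add_le_add_left ?_ _)
          exact norm_sub_le _ _
      _ ≤ _ := by rw [h1, h2, h3, norm_one]; linarith

lemma norm_pow_sub_pow_le_of_norm_le_one {z w : ℂ} (hz : ‖z‖ ≤ 1) (hw : ‖w‖ ≤ 1) (m : ℕ) :
    ‖z ^ m - w ^ m‖ ≤ m * ‖z - w‖ := by
  induction m with
  | zero => simp
  | succ m ih =>
    have e : z ^ (m + 1) - w ^ (m + 1) = z ^ m * (z - w) + (z ^ m - w ^ m) * w := by ring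
    rw [e]
    refine (norm_add_le _ _).trans ?_
    rw [norm_mul, norm_mul, norm_pow]
    have h1 : ‖z‖ ^ m * ‖z - w‖ ≤ 1 * ‖z - w‖ := by
      gcongr; exact pow_le_one₀ (norm_nonneg _) hz
    have h2 : ‖z ^ m - w ^ m‖ * ‖w‖ ≤ (m * ‖z - w‖) * 1 := by gcongr
    push_cast
    linarith

/-- The cubic remainder is controlled through `|y| ^ 3 ≤ ε y ^ 2 + y ^ 4 / ε`, so only second and
fourth moments occur; `ε` is left free for the later choice. -/
lemma norm_integral_cexp_sub_le {S : Type*} [MeasurableSpace S] {μ : Measure S}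
    [IsProbabilityMeasure μ] {Y : S → ℝ} (hY : Measurable Y) (h1 : Integrable Y μ)
    (h2 : Integrable (fun x => Y x ^ 2) μ) (h4 : Integrable (fun x => Y x ^ 4) μ)
    (h0 : ∫ x, Y x ∂μ = 0) (t : ℝ) {ε : ℝ} (hε : 0 < ε) :
    ‖∫ x, Complex.exp ((t * Y x : ℝ) * Complex.I) ∂μ - (1 - (t ^ 2 * ∫ x, Y x ^ 2 ∂μ) / 2 : ℝ)‖
      ≤ 4 * (ε * (t ^ 2 * ∫ x, Y x ^ 2 ∂μ) + t ^ 4 * (∫ x, Y x ^ 4 ∂μ) / ε) := by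
  have hexp : Integrable (fun x => Complex.exp ((t * Y x : ℝ) * Complex.I)) μ := by
    refine (integrable_const (1 : ℝ)).mono' (by fun_prop) (ae_of_all _ fun x => ?_)
    rw [Complex.norm_exp_ofReal_mul_I]
  have hpoly : Integrable (fun x => (1 - (t ^ 2 * Y x ^ 2) / 2 : ℝ)) μ :=
    (integrable_const _).sub ((h2.const_mul _).div_const 2)
  have hlin : Integrable (fun x => ((t * Y x : ℝ) : ℂ) * Complex.I) μ :=
    ((h1.const_mul t).ofReal (𝕜 := ℂ)).mul_const _
  have e1 : ∫ x, Complex.exp ((t * Y x : ℝ) * Complex.I) ∂μ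
      - (1 - (t ^ 2 * ∫ x, Y x ^ 2 ∂μ) / 2 : ℝ)
      = ∫ x, (Complex.exp ((t * Y x : ℝ) * Complex.I) - ((t * Y x : ℝ) : ℂ) * Complex.I
          - ((1 - (t ^ 2 * Y x ^ 2) / 2 : ℝ) : ℂ)) ∂μ := by
    have hpolyC : Integrable (fun x => ((1 - (t ^ 2 * Y x ^ 2) / 2 : ℝ) : ℂ)) μ := hpoly.ofReal
    have e0 := integral_sub (hexp.sub hlin) hpolyC
    simp only [Pi.sub_apply] at e0
    refine Eq.trans ?_ e0.symm
    rw [integral_sub hexp hlin, integral_mul_const,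
      integral_complex_ofReal, integral_complex_ofReal, integral_const_mul, h0,
      integral_sub (integrable_const _) ((h2.const_mul _).div_const 2), integral_div,
      integral_const_mul]
    simp
  rw [e1]
  have hb : Integrable (fun x => 4 * (ε * (t ^ 2 * Y x ^ 2) + t ^ 4 * Y x ^ 4 / ε)) μ :=
    (((h2.const_mul _).const_mul _).add ((h4.const_mul _).div_const _)).const_mul _
  refine (norm_integral_le_of_norm_le hb (ae_of_all _ fun x => ?_)).trans (le_of_eq ?_)
  · have e2 : Complex.exp ((t * Y x : ℝ) * Complex.I) - ((t * Y x : ℝ) : ℂ) * Complex.I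
        - ((1 - (t ^ 2 * Y x ^ 2) / 2 : ℝ) : ℂ)
        = Complex.exp ((t * Y x : ℝ) * Complex.I) - 1 - (t * Y x : ℝ) * Complex.I
          + (t * Y x : ℝ) ^ 2 / 2 := by push_cast; ring
    rw [e2]
    refine (norm_cexp_mul_I_sub_le _).trans ?_
    rw [← mul_pow, ← mul_pow]
    generalize t * Y x = y
    have h5 : |y| ≤ ε + y ^ 2 / ε := by
      rw [← sub_nonneg]
      have : ε + y ^ 2 / ε - |y| = ((ε - |y| / 2) ^ 2 + 3 / 4 * |y| ^ 2) / ε := by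
        rw [← sq_abs y]; field_simp; ring
      rw [this]; positivity
    have h6 : |y| ^ 3 ≤ ε * y ^ 2 + y ^ 4 / ε := by
      calc |y| ^ 3 = y ^ 2 * |y| := by rw [← sq_abs y]; ring
        _ ≤ y ^ 2 * (ε + y ^ 2 / ε) := by gcongr
        _ = _ := by ring
    linarith
  · rw [integral_const_mul, integral_add ((h2.const_mul _).const_mul _)
      ((h4.const_mul _).div_const _), integral_const_mul, integral_div, integral_const_mul,
      integral_const_mul]

/-- The limit is written as the `k`-th power of `exp (-t² / (2k))`. For numbers in the unit disc the
difference of `k`-th powers is at most `k` times the difference, so an error `o(1/k)` for one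
summand is enough. -/
lemma tendsto_charFun_surprisal_pow (c : WalkKind) {F : Filter ℕ} {k : ℕ → ℕ} {s : ℕ → ℝ≥0}
    (hk : Tendsto (fun N => (k N : ℝ)) F atTop) (hv : ∀ᶠ N in F, 0 < walkVarentropy c (s N))
    (hL : Tendsto (fun N => surprisalKurtosis c (s N) / k N) F (𝓝 0)) (t : ℝ) :
    Tendsto (fun N => (∫ x, Complex.exp (((√(walkVarentropy c (s N) * k N))⁻¹ * t *
      (surprisal c (s N) x - walkEntropy c (s N)) : ℝ) * Complex.I) ∂(rateOneLaw c (s N))) ^ k N) F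
      (𝓝 (Complex.exp (-t ^ 2 / 2 : ℝ))) := by
  have hkinv : Tendsto (fun N => ((k N : ℝ))⁻¹) F (𝓝 0) := tendsto_inv_atTop_zero.comp hk
  have hr : Tendsto (fun N => √(surprisalKurtosis c (s N) / k N + (k N : ℝ)⁻¹)) F (𝓝 0) := by
    have := (hL.add hkinv).sqrt
    simpa using this
  have hb : Tendsto (fun N => 4 * √(surprisalKurtosis c (s N) / k N + (k N : ℝ)⁻¹)
      * (t ^ 2 + t ^ 4) + t ^ 4 / 4 * (k N : ℝ)⁻¹) F (𝓝 0) := by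
    simpa using ((hr.const_mul 4).mul_const (t ^ 2 + t ^ 4)).add (hkinv.const_mul (t ^ 4 / 4))
  rw [tendsto_iff_norm_sub_tendsto_zero]
  refine squeeze_zero' (Eventually.of_forall fun _ => norm_nonneg _) ?_ hb
  filter_upwards [hv, hk.eventually_gt_atTop 0, hk.eventually_ge_atTop (t ^ 2 / 2)]
    with N hv hk hkt
  set v := walkVarentropy c (s N)
  set h := walkEntropy c (s N)
  set K := surprisalKurtosis c (s N) with hK
  set κ : ℝ := (k N : ℝ)
  have hK0 : 0 ≤ K := surprisalKurtosis_nonneg c _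
  -- The choice `ε = √r` makes both error terms of order `√r / κ`; the added `κ⁻¹` keeps `r`
  -- positive even when `K` might vanish.
  set r := K / κ + κ⁻¹ with hr
  have hr0 : 0 < r := by positivity
  set τ := (√(v * κ))⁻¹ * t with hτ
  have hτ2 : τ ^ 2 * v = t ^ 2 / κ := by
    rw [hτ, mul_pow, inv_pow, Real.sq_sqrt (by positivity)]; field_simp
  have i1 : Integrable (fun x => surprisal c (s N) x - h) (rateOneLaw c (s N)) := by
    simpa using integrable_surprisal_sub_pow c (s N) h 1
  have i0 : ∫ x, (surprisal c (s N) x - h) ∂(rateOneLaw c (s N)) = 0 := by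
    rw [integral_sub (by simpa using integrable_surprisal_pow c (s N) 1) (integrable_const _)]
    simp [h, walkEntropy]
  have i2 : ∫ x, (surprisal c (s N) x - h) ^ 2 ∂(rateOneLaw c (s N)) = v := by
    have := walkVarentropy_eq_sub c (s N) h
    simp only [pow_one, i0] at this
    simpa using this.symm
  have i4 : ∫ x, (surprisal c (s N) x - h) ^ 4 ∂(rateOneLaw c (s N)) = K * v ^ 2 := by
    rw [hK, surprisalKurtosis, div_mul_cancel₀ _ (by positivity)]; rfl
  have hmain := norm_integral_cexp_sub_le (μ := rateOneLaw c (s N))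
    (Y := fun x => surprisal c (s N) x - h) .of_discrete i1
    (integrable_surprisal_sub_pow c (s N) h 2) (integrable_surprisal_sub_pow c (s N) h 4) i0 τ
    (Real.sqrt_pos.2 hr0)
  rw [i2, i4, hτ2] at hmain
  set φ := ∫ x, Complex.exp ((τ * (surprisal c (s N) x - h) : ℝ) * Complex.I)
    ∂(rateOneLaw c (s N)) with hφ
  have hφ1 : ‖φ‖ ≤ 1 := by
    refine (norm_integral_le_integral_norm _).trans (le_of_eq ?_)
    simp_rw [Complex.norm_exp_ofReal_mul_I]; simp
  set y := t ^ 2 / κ / 2 with hy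
  have hy0 : 0 ≤ y := by positivity
  have hy1 : y ≤ 1 := by rw [hy, div_div, div_le_one (by positivity)]; linarith
  set w : ℂ := ((Real.exp (-y) : ℝ) : ℂ) with hw
  have hw1 : ‖w‖ ≤ 1 := by
    rw [hw, Complex.norm_real, Real.norm_of_nonneg (Real.exp_nonneg _)]
    exact Real.exp_le_one_iff.2 (by linarith)
  have hwk : w ^ k N = Complex.exp (-t ^ 2 / 2 : ℝ) := by
    rw [hw, ← Complex.ofReal_pow, ← Real.exp_nat_mul, ← Complex.ofReal_exp]
    congr 2
    change κ * -y = _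
    rw [hy]; field_simp
  have hwy : ‖((1 - y : ℝ) : ℂ) - w‖ ≤ y ^ 2 := by
    rw [hw, ← Complex.ofReal_sub, Complex.norm_real, Real.norm_eq_abs, abs_sub_comm]
    have := Real.abs_exp_sub_one_sub_id_le (x := -y) (by rw [abs_neg, abs_of_nonneg hy0]; exact hy1)
    rw [neg_sq] at this
    convert this using 2
    ring
  rw [← hwk]
  refine (norm_pow_sub_pow_le_of_norm_le_one hφ1 hw1 _).trans ?_
  change κ * _ ≤ _
  have htri : ‖φ - w‖ ≤ ‖φ - ((1 - y : ℝ) : ℂ)‖ + ‖((1 - y : ℝ) : ℂ) - w‖ := by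
    have := norm_add_le (φ - ((1 - y : ℝ) : ℂ)) (((1 - y : ℝ) : ℂ) - w)
    simpa using this
  have h4 : τ ^ 4 * (K * v ^ 2) / √r ≤ t ^ 4 * √r / κ := by
    have e : τ ^ 4 * (K * v ^ 2) = (t ^ 2 / κ) ^ 2 * K := by rw [← hτ2]; ring
    rw [e, div_le_iff₀ (Real.sqrt_pos.2 hr0)]
    have e2 : t ^ 4 * √r / κ * √r = t ^ 4 / κ * r := by
      have := Real.mul_self_sqrt hr0.le
      calc _ = t ^ 4 / κ * (√r * √r) := by ring
        _ = _ := by rw [this]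
    rw [e2]
    have : K / κ ≤ r := by rw [hr]; linarith [inv_pos.2 hk]
    calc (t ^ 2 / κ) ^ 2 * K = t ^ 4 / κ * (K / κ) := by field_simp
      _ ≤ _ := by gcongr
  have hfin : ‖φ - w‖ ≤ 4 * (√r * (t ^ 2 / κ) + t ^ 4 * √r / κ) + y ^ 2 := by linarith
  calc κ * ‖φ - w‖ ≤ κ * (4 * (√r * (t ^ 2 / κ) + t ^ 4 * √r / κ) + y ^ 2) := by gcongr
    _ = _ := by rw [hy]; field_simp; ring

/-! ### The law of the auxiliary walk -/

section Walk

variable {Ω : Type*} [MeasurableSpace Ω] {c : WalkKind} {k : ℕ} {P : Measure Ω}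
  {W : ℝ≥0 → Ω → Fin k → ℤ}

lemma IsCoordinateWalk.map_eq {r : ℝ≥0} {X : ℝ≥0 → Ω → ℤ} (h : IsCoordinateWalk c r P X)
    (t : ℝ≥0) : P.map (X t) = rateOneLaw c (r * t) := by
  have h1 := h.increment_law 0 t zero_le
  rw [tsub_zero] at h1
  rw [← h1]
  refine Measure.map_congr ?_
  filter_upwards [h.start_zero] with ω hω
  rw [hω, sub_zero]

namespace IsAuxiliaryWalk

lemma measurable_coord (h : IsAuxiliaryWalk c k P W) (t : ℝ≥0) (i : Fin k) :
    Measurable fun ω => W t ω i := (h.coordinate i).measurable t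

lemma measurable (h : IsAuxiliaryWalk c k P W) (t : ℝ≥0) : Measurable (W t) :=
  measurable_pi_lambda _ (h.measurable_coord t)

lemma map_coord (h : IsAuxiliaryWalk c k P W) (t : ℝ≥0) (i : Fin k) :
    P.map (fun ω => W t ω i) = rateOneLaw c (t / k) := by
  rw [(h.coordinate i).map_eq t]
  congr 1
  rw [one_div, mul_comm, div_eq_mul_inv]

lemma iIndepFun_coord (h : IsAuxiliaryWalk c k P W) (t : ℝ≥0) :
    iIndepFun (fun i ω => W t ω i) P :=
  h.independent.comp (fun _ f => f t) fun _ => measurable_pi_apply t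

lemma map_eq_pi [IsProbabilityMeasure P] (h : IsAuxiliaryWalk c k P W) (t : ℝ≥0) :
    P.map (W t) = Measure.pi fun _ => rateOneLaw c (t / k) := by
  have := (iIndepFun_iff_map_fun_eq_pi_map fun i => (h.measurable_coord t i).aemeasurable).1
    (h.iIndepFun_coord t)
  simp_rw [h.map_coord] at this
  exact this

/-- The equality is only almost sure because the logarithm of the product splits only where every
factor is nonzero. -/
lemma logLik_ae_eq [IsProbabilityMeasure P] (h : IsAuxiliaryWalk c k P W) (t : ℝ≥0) :
    logLik P W t =ᵐ[P] fun ω => ∑ i, surprisal c (t / k) (W t ω i) := by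
  have hpos : ∀ᵐ ω ∂P, ∀ i, walkPmf c (t / k) (W t ω i) ≠ 0 := by
    rw [ae_all_iff]
    intro i
    have h1 : ∀ᵐ x ∂(rateOneLaw c (t / k)), walkPmf c (t / k) x ≠ 0 := by
      rw [ae_iff_of_countable]
      intro x hx
      rw [walkPmf, measureReal_def, ENNReal.toReal_ne_zero]
      exact ⟨hx, measure_ne_top _ _⟩
    rw [← h.map_coord t i] at h1
    exact ae_of_ae_map (h.measurable_coord t i).aemeasurable h1
  filter_upwards [hpos] with ω hω
  have e : (P.map (W t)).real {W t ω} = ∏ i, walkPmf c (t / k) (W t ω i) := by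
    rw [h.map_eq_pi t, measureReal_def, Measure.pi_singleton, ENNReal.toReal_prod]
    rfl
  rw [logLik, negLogMass, e, Real.log_prod fun i _ => hω i]
  simp [surprisal]

lemma measurable_logLik (h : IsAuxiliaryWalk c k P W) (t : ℝ≥0) : Measurable (logLik P W t) :=
  (Measurable.of_discrete (f := negLogMass (P.map (W t)))).comp (h.measurable t)

lemma variance_logLik [IsProbabilityMeasure P] (h : IsAuxiliaryWalk c k P W) (t : ℝ≥0) :
    Var[logLik P W t; P] = varQ₁ c k t * k := by
  rw [variance_congr (h.logLik_ae_eq t)]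
  have hm : ∀ i : Fin k, MemLp (fun ω => surprisal c (t / k) (W t ω i)) 2 P := fun i => by
    have := memLp_surprisal c (t / k)
    rw [← h.map_coord t i] at this
    exact this.comp_of_map (h.measurable_coord t i).aemeasurable
  have hind : iIndepFun (fun i ω => surprisal c (t / k) (W t ω i)) P :=
    (h.iIndepFun_coord t).comp (fun _ => surprisal c (t / k)) fun _ => .of_discrete
  have hv := IndepFun.variance_sum (s := Finset.univ) (fun i _ => hm i)
    (fun i _ j _ hij => hind.indepFun hij)
  have e : (fun ω => ∑ i, surprisal c (t / k) (W t ω i))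
      = ∑ i, fun ω => surprisal c (t / k) (W t ω i) := by ext; simp
  rw [e, hv]
  have h1 : ∀ i : Fin k, Var[fun ω => surprisal c (t / k) (W t ω i); P] = varQ₁ c k t := by
    intro i
    have := variance_map (X := surprisal c (t / k)) (Y := fun ω => W t ω i) (μ := P)
      .of_discrete (h.measurable_coord t i).aemeasurable
    rw [h.map_coord t i] at this
    exact this.symm
  simp_rw [h1]
  simp [mul_comm]

lemma charFun_logLik [IsProbabilityMeasure P] (h : IsAuxiliaryWalk c k P W) (t : ℝ≥0) (a b θ : ℝ) :
    charFun (P.map fun ω => a * (logLik P W t ω - b)) θ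
      = Complex.exp ((a * (k * walkEntropy c (t / k) - b) * θ : ℝ) * Complex.I)
        * (∫ x, Complex.exp ((a * θ * (surprisal c (t / k) x - walkEntropy c (t / k)) : ℝ)
            * Complex.I) ∂(rateOneLaw c (t / k))) ^ k := by
  set e := walkEntropy c (t / k)
  let Y : Fin k → Ω → ℝ := fun i ω => surprisal c (t / k) (W t ω i) - e
  have hYm : ∀ i, AEMeasurable (Y i) P := fun i =>
    ((Measurable.of_discrete (f := fun x => surprisal c (t / k) x - e)).comp
      (h.measurable_coord t i)).aemeasurable
  have hind : iIndepFun Y P :=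
    (h.iIndepFun_coord t).comp (fun _ x => surprisal c (t / k) x - e) fun _ => .of_discrete
  have hsum := congrFun (hind.charFun_map_fun_sum_eq_prod hYm) (a * θ)
  have hYc : ∀ i, charFun (P.map (Y i)) (a * θ) = ∫ x, Complex.exp ((a * θ *
      (surprisal c (t / k) x - e) : ℝ) * Complex.I) ∂(rateOneLaw c (t / k)) := by
    intro i
    rw [charFun_apply_real, integral_map (hYm i) (by fun_prop), ← h.map_coord t i,
      integral_map (h.measurable_coord t i).aemeasurable .of_discrete]
    refine integral_congr_ae (ae_of_all _ fun ω => ?_)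
    simp only [Y]; push_cast; rfl
  rw [Finset.prod_apply] at hsum
  simp_rw [hYc] at hsum
  rw [Finset.prod_const, Finset.card_univ, Fintype.card_fin] at hsum
  rw [← hsum, charFun_apply_real, charFun_apply_real,
    integral_map (Finset.aemeasurable_fun_sum _ fun i _ => hYm i) (by fun_prop),
    integral_map (((h.measurable_logLik t).sub_const b).const_mul a).aemeasurable (by fun_prop),
    ← integral_const_mul]
  refine integral_congr_ae ?_
  filter_upwards [h.logLik_ae_eq t] with ω hω
  rw [hω, ← Complex.exp_add]
  congr 1
  simp only [Y, Finset.sum_sub_distrib, Finset.sum_const, Finset.card_univ, Fintype.card_fin]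
  simp only [nsmul_eq_mul]
  push_cast
  ring

end IsAuxiliaryWalk

end Walk

/-! ### From characteristic functions to distribution functions. -/

lemma gaussianReal_Iic_zero (α : ℝ) : (gaussianReal α 1).real (Set.Iic 0) = gaussianTail α := by
  have h : (gaussianReal 0 1).map (fun x => α - x) = gaussianReal α 1 := by
    simpa using gaussianReal_map_const_sub (μ := 0) (v := 1) α
  rw [gaussianTail, ← h, map_measureReal_apply (by fun_prop) measurableSet_Iic]
  congr 1
  ext x; simp

/-- The central limit theorem for `Q(t)`, under the Lyapunov condition. -/
theorem tendsto_measureReal_logLik_le {c : WalkKind} {k : ℕ → ℕ} {Ω : ℕ → Type*}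
    [∀ N, MeasurableSpace (Ω N)] {P : ∀ N, Measure (Ω N)} [∀ N, IsProbabilityMeasure (P N)]
    {W : ∀ N, ℝ≥0 → Ω N → Fin (k N) → ℤ} (hW : ∀ N, IsAuxiliaryWalk c (k N) (P N) (W N))
    {t : ℕ → ℝ≥0} (hk : Tendsto (fun N => (k N : ℝ)) atTop atTop)
    (hv : ∀ᶠ N in atTop, 0 < walkVarentropy c (t N / k N))
    (hL : Tendsto (fun N => surprisalKurtosis c (t N / k N) / k N) atTop (𝓝 0))
    {b : ℕ → ℝ} {α : ℝ}
    (hb : Tendsto (fun N => (√(walkVarentropy c (t N / k N) * k N))⁻¹ *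
      (k N * walkEntropy c (t N / k N) - b N)) atTop (𝓝 α)) :
    Tendsto (fun N => (P N).real {ω | logLik (P N) (W N) (t N) ω ≤ b N}) atTop
      (𝓝 (gaussianTail α)) := by
  set a : ℕ → ℝ := fun N => (√(walkVarentropy c (t N / k N) * k N))⁻¹ with ha
  have hm : ∀ N, Measurable fun ω => a N * (logLik (P N) (W N) (t N) ω - b N) := fun N =>
    (((hW N).measurable_logLik (t N)).sub_const _).const_mul _
  -- `Q` is centred at the threshold `b N` and not at its mean, so the event becomes the fixed
  -- half-line `(-∞, 0]` and the limit law is normal with mean `α`.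
  let ρ : ℕ → ProbabilityMeasure ℝ := fun N =>
    ⟨(P N).map fun ω => a N * (logLik (P N) (W N) (t N) ω - b N),
      Measure.isProbabilityMeasure_map (hm N).aemeasurable⟩
  let ρ₀ : ProbabilityMeasure ℝ := ⟨gaussianReal α 1, inferInstance⟩
  have hconv : Tendsto ρ atTop (𝓝 ρ₀) := by
    refine ProbabilityMeasure.tendsto_iff_tendsto_charFun.2 fun θ => ?_
    simp only [ρ, ρ₀, ProbabilityMeasure.coe_mk]
    simp_rw [fun N => (hW N).charFun_logLik (t N) (a N) (b N) θ]
    rw [charFun_gaussianReal]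
    have h1 := tendsto_charFun_surprisal_pow c hk hv hL θ
    have h2 : Tendsto (fun N => Complex.exp ((a N * (k N * walkEntropy c (t N / k N) - b N) * θ : ℝ)
        * Complex.I)) atTop (𝓝 (Complex.exp ((α * θ : ℝ) * Complex.I))) := by
      have hc : Continuous fun x : ℝ => Complex.exp ((x * θ : ℝ) * Complex.I) := by fun_prop
      exact (hc.tendsto α).comp hb
    have h3 := h2.mul h1
    rw [← Complex.exp_add] at h3
    convert h3 using 2
    push_cast
    congr 1
    ring
  -- The limit law has no atom at `0`, so the half-line is a continuity set for weak convergence.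
  have hfr : (ρ₀ : Measure ℝ) (frontier (Set.Iic 0)) = 0 := by
    rw [frontier_Iic]
    have : NullSingletonClass (gaussianReal α 1) := nullSingletonClass_gaussianReal (by simp)
    exact measure_singleton (μ := gaussianReal α 1) 0
  have h4 := ProbabilityMeasure.tendsto_measure_of_null_frontier_of_tendsto' hconv hfr
  have h5 := (ENNReal.tendsto_toReal (measure_ne_top _ _)).comp h4
  rw [← gaussianReal_Iic_zero]
  refine h5.congr' ?_
  filter_upwards [hv, hk.eventually_gt_atTop 0] with N hv hk
  have ha0 : 0 < a N := inv_pos.2 (Real.sqrt_pos.2 (mul_pos hv hk))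
  simp only [Function.comp, ρ, ProbabilityMeasure.coe_mk]
  rw [Measure.map_apply (hm N) measurableSet_Iic, measureReal_def]
  congr 2
  ext ω
  simp only [Set.mem_preimage, Set.mem_Iic, Set.mem_ofPred_eq]
  rw [mul_nonpos_iff_pos_imp_nonpos]
  constructor
  · intro h
    linarith [h.1 ha0]
  · intro h
    exact ⟨fun _ => by linarith, fun _ => ha0.le⟩

/-! ### Entropic and cutoff times -/

lemma walkEntropy_entropyHomeo_symm (c : WalkKind) {y : ℝ} (hy : 0 ≤ y) :
    walkEntropy c ((entropyHomeo c).symm y.toNNReal) = y := by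
  rw [← coe_entropyHomeo, Homeomorph.apply_symm_apply, Real.coe_toNNReal _ hy]

lemma existsUnique_walkEntropy_div_eq (c : WalkKind) {k : ℕ} (hk : 0 < (k : ℝ)) {y : ℝ}
    (hy : 0 ≤ y) : ∃! t : ℝ≥0, walkEntropy c (t / k) = y := by
  have hk0 : (k : ℝ≥0) ≠ 0 := by exact_mod_cast hk.ne'
  have he := walkEntropy_entropyHomeo_symm c hy
  refine ⟨(entropyHomeo c).symm y.toNNReal * k, ?_, fun t ht => ?_⟩
  · simpa only [mul_div_cancel_right₀ _ hk0] using he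
  · rw [← (walkEntropy_strictMono c).injective (ht.trans he.symm), div_mul_cancel₀ _ hk0]

namespace EntropicRegime

variable {c : WalkKind} {k : ℕ → ℕ} {l : ℕ → ℝ} {s s' : ℕ → ℝ≥0}

lemma tendsto_sqrt_div (h : EntropicRegime c atTop k l s) :
    Tendsto (fun N => √(walkVarentropy c (s N) * k N) / l N) atTop (𝓝 0) := by
  have hr : Tendsto (fun N => walkEntropy c (s N) / walkEntropy c (s N)) atTop (𝓝 1) := by
    refine tendsto_const_nhds.congr' ?_
    filter_upwards [h.eventually_pos] with N hN
    exact (div_self (walkEntropy_pos c hN.1).ne').symm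
  have h1 := (h.conclusion hr).window.sqrt
  rw [Real.sqrt_zero] at h1
  refine h1.congr' ?_
  filter_upwards [h.eventually_pos] with N hN
  rw [Real.sqrt_div' _ (sq_nonneg _), Real.sqrt_sq hN.2.2.1.le]

lemma tendsto_one_add (h : EntropicRegime c atTop k l s) (α : ℝ) :
    Tendsto (fun N => 1 + α * (√(walkVarentropy c (s N) * k N) / l N)) atTop (𝓝 1) := by
  simpa using (h.tendsto_sqrt_div.const_mul α).const_add 1

/-- For negative `α` the prescribed entropy could be negative, and no cutoff time would exist;
`√(vk) = o(l)` excludes this for large `N`. -/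
lemma eventually_add_nonneg (h : EntropicRegime c atTop k l s) (α : ℝ) :
    ∀ᶠ N in atTop, 0 ≤ l N + α * √(walkVarentropy c (s N) * k N) := by
  filter_upwards [(h.tendsto_one_add α).eventually_const_lt one_pos, h.eventually_pos]
    with N h1 h2
  have h3 := mul_pos h1 h2.2.2.1
  have hl := h2.2.2.1.ne'
  have e : (1 + α * (√(walkVarentropy c (s N) * k N) / l N)) * l N
      = l N + α * √(walkVarentropy c (s N) * k N) := by field_simp
  rw [e] at h3
  exact h3.le

lemma conclusion_of_cutoff (h : EntropicRegime c atTop k l s) {α : ℝ}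
    (hs' : ∀ᶠ N in atTop, walkEntropy c (s' N)
      = (l N + α * √(walkVarentropy c (s N) * k N)) / k N) : Conclusion c atTop k l s s' := by
  refine h.conclusion ((h.tendsto_one_add α).congr' ?_)
  filter_upwards [hs', h.entropy, h.eventually_pos] with N h1 h2 h3
  obtain ⟨-, hk, hl, -⟩ := h3
  rw [h1, h2]
  field_simp

/-- The normalised centring of the cutoff window, shifted by `ε (v k) ^ (1 / 4)`. -/
lemma tendsto_normalized_centre (h : EntropicRegime c atTop k l s) {α : ℝ}
    (hs' : ∀ᶠ N in atTop, walkEntropy c (s' N)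
      = (l N + α * √(walkVarentropy c (s N) * k N)) / k N) (ε : ℝ) :
    Tendsto (fun N => (√(walkVarentropy c (s' N) * k N))⁻¹ * (k N * walkEntropy c (s' N)
      - (l N + ε * (walkVarentropy c (s N) * k N) ^ (1 / 4 : ℝ)))) atTop (𝓝 α) := by
  have hC := h.conclusion_of_cutoff hs'
  have h1 : Tendsto (fun N => (√(walkVarentropy c (s' N) / walkVarentropy c (s N)))⁻¹) atTop
      (𝓝 1) := by
    simpa using hC.ratio.sqrt.inv₀ (by simp)
  -- The shift relative to the standard deviation, `(vk)^(1/4) / (vk)^(1/2)`, vanishes, so either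
  -- sign of `ω` gives the same limit.
  have h2 : Tendsto (fun N => (walkVarentropy c (s N) * k N) ^ (-(1 / 4 : ℝ))) atTop (𝓝 0) :=
    (tendsto_rpow_neg_atTop (by norm_num)).comp hC.variance
  have h3 := h1.mul ((h2.const_mul ε).const_sub α)
  rw [mul_zero, sub_zero, one_mul] at h3
  refine h3.congr' ?_
  filter_upwards [hs', h.eventually_pos, hC.variance.eventually_gt_atTop 0] with N e hp hv
  obtain ⟨-, hk, hl, -⟩ := hp
  have hv0 : 0 < walkVarentropy c (s N) := pos_of_mul_pos_left hv hk.le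
  have hkh : k N * walkEntropy c (s' N) = l N + α * √(walkVarentropy c (s N) * k N) := by
    rw [e]; field_simp
  rw [hkh]
  set a := walkVarentropy c (s N) * k N
  have e1 : walkVarentropy c (s' N) * k N
      = walkVarentropy c (s' N) / walkVarentropy c (s N) * a := by
    simp only [a]; field_simp
  have e2 : a ^ (1 / 4 : ℝ) = √a * a ^ (-(1 / 4 : ℝ)) := by
    rw [Real.sqrt_eq_rpow, ← Real.rpow_add hv]; norm_num
  have ha : √a ≠ 0 := (Real.sqrt_pos.2 hv).ne'
  rw [e1, Real.sqrt_mul' _ hv.le, e2, mul_inv]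
  field_simp
  ring

end EntropicRegime

/-! ### Assembly of the proposition. -/

theorem mainTheorem4 (c : WalkKind) (n k : ℕ → ℕ)
    (hk : Tendsto k atTop atTop)
    (hkn : (fun N => Real.log (k N)) =o[atTop] (fun N => Real.log (n N))) :
    -- `Q₁(t)` is square integrable, so that its mean and variance are meaningful
    (∀ (j : ℕ) (t : ℝ≥0), MemLp (negLogMass (coordLaw c j t)) 2 (coordLaw c j t)) ∧
    -- the entropic time and the cutoff times are eventually well defined
    (∀ᶠ N in atTop, ∃! t₀ : ℝ≥0, IsEntropicTime c (n N) (k N) t₀) ∧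
    (∀ α : ℝ, ∀ᶠ N in atTop, ∀ t₀ : ℝ≥0, IsEntropicTime c (n N) (k N) t₀ →
      ∃! t : ℝ≥0, IsCutoffTime c (n N) (k N) t₀ α t) ∧
    -- the central limit theorem
    (∀ (Ω : ℕ → Type*) [∀ N, MeasurableSpace (Ω N)] (P : ∀ N, Measure (Ω N))
      [∀ N, IsProbabilityMeasure (P N)] (W : ∀ N, ℝ≥0 → Ω N → Fin (k N) → ℤ),
      (∀ N, IsAuxiliaryWalk c (k N) (P N) (W N)) →
      ∀ t₀ : ℕ → ℝ≥0, (∀ᶠ N in atTop, IsEntropicTime c (n N) (k N) (t₀ N)) →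
      ∀ (α : ℝ) (t : ℕ → ℝ≥0),
      (∀ᶠ N in atTop, IsCutoffTime c (n N) (k N) (t₀ N) α (t N)) →
      ∀ w : ℕ → ℝ,
      (∀ N, w N = Var[logLik (P N) (W N) (t₀ N); P N] ^ (1 / 4 : ℝ)) →
      (∀ N, w N = (varQ₁ c (k N) (t₀ N) * k N) ^ (1 / 4 : ℝ)) ∧
      Tendsto (fun N => (P N).real
          {ω | logLik (P N) (W N) (t N) ω ≤ Real.log (n N) + w N})
        atTop (𝓝 (gaussianTail α)) ∧
      Tendsto (fun N => (P N).real
          {ω | logLik (P N) (W N) (t N) ω ≤ Real.log (n N) - w N})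
        atTop (𝓝 (gaussianTail α))) := by
  have hkR : Tendsto (fun N => (k N : ℝ)) atTop atTop := tendsto_natCast_atTop_atTop.comp hk
  -- Eventually `log k ≤ log n`, so `k → ∞` forces `log n → ∞`.
  have hlog : Tendsto (fun N => Real.log (n N)) atTop atTop := by
    refine tendsto_atTop_mono' _ ?_ (Real.tendsto_log_atTop.comp hkR)
    filter_upwards [hkn.bound one_pos] with N hN
    rw [one_mul, Real.norm_eq_abs, Real.norm_eq_abs,
      abs_of_nonneg (Real.log_natCast_nonneg (n N))] at hN
    exact (le_abs_self _).trans hN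
  have regime : ∀ s : ℕ → ℝ≥0, (∀ᶠ N in atTop, walkEntropy c (s N) = Real.log (n N) / k N) →
      EntropicRegime c atTop k (fun N => Real.log (n N)) s := fun s hs =>
    ⟨hkR, hlog, hkn.tendsto_div_nhds_zero, hs⟩
  refine ⟨fun j t => memLp_surprisal c (t / j), ?_, fun α => ?_, ?_⟩
  · filter_upwards [hkR.eventually_gt_atTop 0] with N hN
    exact existsUnique_walkEntropy_div_eq c hN
      (div_nonneg (Real.log_natCast_nonneg _) (Nat.cast_nonneg _))
  · have hy : ∀ N, 0 ≤ Real.log (n N) / k N := fun N =>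
      div_nonneg (Real.log_natCast_nonneg _) (Nat.cast_nonneg _)
    -- The threshold on `N` must not depend on `t₀`. The rescaled entropic time is therefore fixed
    -- explicitly, and injectivity of the entropy identifies it with `t₀ / k`.
    set s : ℕ → ℝ≥0 := fun N => (entropyHomeo c).symm (Real.log (n N) / k N).toNNReal
    have he : ∀ N, walkEntropy c (s N) = Real.log (n N) / k N := fun N =>
      walkEntropy_entropyHomeo_symm c (hy N)
    filter_upwards [(regime s (.of_forall he)).eventually_add_nonneg α,
      hkR.eventually_gt_atTop 0] with N h1 hN t₀ ht₀
    have h2 : t₀ / k N = s N := (walkEntropy_strictMono c).injective (ht₀.trans (he N).symm)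
    have h3 : varQ₁ c (k N) t₀ = walkVarentropy c (s N) := by rw [← h2]; rfl
    rw [← h3] at h1
    exact existsUnique_walkEntropy_div_eq c hN (div_nonneg h1 hN.le)
  · intro Ω _ P _ W hW t₀ ht₀ α t ht w hw
    have hw' : ∀ N, w N = (varQ₁ c (k N) (t₀ N) * k N) ^ (1 / 4 : ℝ) := fun N => by
      rw [hw, (hW N).variance_logLik]
    have hreg := regime (fun N => t₀ N / k N) ht₀
    have hC := hreg.conclusion_of_cutoff (s' := fun N => t N / k N) ht
    have hv : ∀ᶠ N in atTop, 0 < walkVarentropy c (t N / k N) := by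
      filter_upwards [hC.ratio.eventually_const_lt one_pos] with N hN
      by_contra h0
      have h1 : walkVarentropy c (t N / k N) = 0 :=
        le_antisymm (not_lt.1 h0) (variance_nonneg _ _)
      rw [h1, zero_div] at hN
      exact lt_irrefl _ hN
    refine ⟨hw', ?_, ?_⟩
    · refine tendsto_measureReal_logLik_le hW hkR hv hC.lyapunov
        ((hreg.tendsto_normalized_centre (s' := fun N => t N / k N) ht 1).congr fun N => ?_)
      rw [hw', one_mul]; rfl
    · refine tendsto_measureReal_logLik_le hW hkR hv hC.lyapunov
        ((hreg.tendsto_normalized_centre (s' := fun N => t N / k N) ht (-1)).congr fun N => ?_)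
      rw [hw', neg_one_mul, ← sub_eq_add_neg]; rfl
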